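/- Let $F:\mathbb{R}^n\rightrightarrows\mathbb{R}^n$ be a multifunction with nonempty, convex, compact values that is locally Lipschitz (every point has a neighbourhood $K$ and a constant $c>0$ with $F(z)\subset F(y)+c|z-y|B$ for all $z,y\in K$, $B$ being the closed unit ball) and has at most linear growth ($|v|\le\gamma(1+|x|)$ for some $\gamma>0$ and all $x$, $v\in F(x)$). Let $H(x,p)=\sup_{v\in F(x)}\langle v,p\rangle$, and suppose that $H\in C^{2,1}_{loc}(\mathbb{R}^n\times(\mathbb{R}^n\smallsetminus\{0\}))$, i.e. $H$ is $C^2$ there with locally Lipschitz second derivatives. Let $\phi:\mathbb{R}^n\to\mathbb{R}$ be locally Lipschitz and $t_0\le T$. For $t\le T$ let $$V(t,z)=\inf\{\phi(x(T)) : x:[t,T]\to\mathbb{R}^n \text{ absolutely continuous},\ \dot x(s)\in F(x(s)) \text{ for a.e. } s\in[t,T],\ x(t)=z\}.$$ For $f:\mathbb{R}^n\to\mathbb{R}$, $J^{2,-}f(x)$ denotes the set of subjets of $f$ at $x$: the pairs $(q,Q)$ of a vector $q\in\mathbb{R}^n$ and a symmetric $n\times n$ matrix $Q$ such that $f(y)\ge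 f(x)+\langle q,y-x\rangle+\tfrac12\langle Q(y-x),y-x\rangle+o(|y-x|^2)$ for $y$ near $x$; $J^{2,-}_xV(t,z)$ is the set of subjets of $V(t,\cdot)$ at $z$. Let $\overline x:[t_0,T]\to\mathbb{R}^n$ be optimal for $V(t_0,x_0)$, i.e. an absolutely continuous solution of $\dot x\in F(x)$ a.e., $x(t_0)=x_0$, minimizing $\phi(x(T))$ among all such solutions. Let $\overline p:[t_0,T]\to\mathbb{R}^n\smallsetminus\{0\}$ be a nonvanishing dual arc associated with $\overline x$: $\overline p$ is absolutely continuous, $$\dot{\overline x}(t)\in\partial_p^-H(\overline x(t),\overline p(t)),\qquad -\dot{\overline p}(t)\in\partial_x^-H(\overline x(t),\overline p(t))\qquad\text{for a.e. } t\in[t_0,T],$$ where $\partial_p^-$ and $\partial_x^-$ are the partial Fréchet subdifferentials, and $-\overline p(T)\in\partial\phi(\overline x(T))$, the Clarke generalized gradient. Suppose that for some symmetric $n\times n$ matrix $R_0$ $$(-\overline p(t_0),-R_0)\in J^{2,-}_xV(t_0,x_0).$$ Consider the matrix Riccati equation $$\dot R(t)+H_{px}[t]R(t)+R(t)H_{xp}[t]+R(t)H_{pp}[t]R(t)+H_{xx}[t]=0,\qquad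 R(t_0)=R_0,\qquad(\ast)$$ where $H_{xx}[t],H_{px}[t],H_{xp}[t],H_{pp}[t]$ are the blocks of second partial derivatives of $H$ at $(\overline x(t),\overline p(t))$, with $(H_{px})_{ij}=\partial^2H/\partial x_i\partial p_j$ and $H_{xp}=H_{px}^*$. If the solution $R$ of $(\ast)$ is defined on $[t_0,a]$ for some $a\in(t_0,T]$, then $$(-\overline p(t),-R(t))\in J^{2,-}_xV(t,\overline x(t))\qquad\text{for all } t\in[t_0,a].$$ Moreover, if $\phi$ is locally semiconcave (near every point, for some constant $c$, $\phi(x+h)+\phi(x-h)-2\phi(x)\le c|h|^2$), then $a$ may be taken equal to $T$: the solution of $(\ast)$ exists on all of $[t_0,T]$, and the inclusion holds for all $t\in[t_0,T]$. -/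

import Mathlib

open Set Filter Topology MeasureTheory

/-- The Euclidean space `ℝⁿ`. -/
abbrev Euc (n : ℕ) : Type := EuclideanSpace ℝ (Fin n)

namespace MayerJets

noncomputable section

/-! ### Data of the Mayer problem -/

/-- A multifunction is locally Lipschitz if every point has a neighbourhood `K` and a constant `c`
with `F z ⊆ F y + c |z - y| B` for all `z, y ∈ K`. -/
def LocallyLipschitzMultifunction {n : ℕ} (F : Euc n → Set (Euc n)) : Prop :=
  ∀ x, ∃ K ∈ 𝓝 x, ∃ c : ℝ, 0 < c ∧
    ∀ z ∈ K, ∀ y ∈ K, ∀ v ∈ F z, ∃ w ∈ F y, ‖v - w‖ ≤ c * ‖z - y‖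

/-- The standing hypothesis `(SH)` on the multifunction `F`. -/
structure StandingHypothesis {n : ℕ} (F : Euc n → Set (Euc n)) : Prop where
  nonempty : ∀ x, (F x).Nonempty
  convex : ∀ x, Convex ℝ (F x)
  isCompact : ∀ x, IsCompact (F x)
  locallyLipschitz : LocallyLipschitzMultifunction F
  growth : ∃ γ : ℝ, 0 < γ ∧ ∀ x, ∀ v ∈ F x, ‖v‖ ≤ γ * (1 + ‖x‖)

/-- The Hamiltonian `H(x, p) = sup_{v ∈ F(x)} ⟨v, p⟩`, as a function of the pair `(x, p)`. -/
def hamiltonian {n : ℕ} (F : Euc n → Set (Euc n)) (z : Euc n × Euc n) : ℝ :=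
  sSup ((fun v => inner ℝ v z.2) '' F z.1)

/-- An arc (absolutely continuous function) `x` on `[t₀, T]` with `x' ∈ F(x)` almost everywhere.
Values of `x` outside `[t₀, T]` play no role. -/
def IsTrajectory {n : ℕ} (F : Euc n → Set (Euc n)) (t₀ T : ℝ) (x : ℝ → Euc n) : Prop :=
  AbsolutelyContinuousOnInterval x t₀ T ∧
    ∀ᵐ s : ℝ, s ∈ Icc t₀ T → ∃ v ∈ F (x s), HasDerivAt x v s

/-- The value function `V(t, z) = inf {φ(x(T)) : x a trajectory on [t, T], x(t) = z}`
(meaningful for `t ≤ T`). -/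
def valueFunction {n : ℕ} (F : Euc n → Set (Euc n)) (φ : Euc n → ℝ) (T t : ℝ) (z : Euc n) : ℝ :=
  sInf {r : ℝ | ∃ x : ℝ → Euc n, IsTrajectory F t T x ∧ x t = z ∧ r = φ (x T)}

/-- `x` is an optimal solution of the Mayer problem with initial condition `x(t₀) = x₀`. -/
def IsOptimal {n : ℕ} (F : Euc n → Set (Euc n)) (φ : Euc n → ℝ) (T t₀ : ℝ) (x₀ : Euc n)
    (x : ℝ → Euc n) : Prop :=
  IsTrajectory F t₀ T x ∧ x t₀ = x₀ ∧
    ∀ y : ℝ → Euc n, IsTrajectory F t₀ T y → y t₀ = x₀ → φ (x T) ≤ φ (y T)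

/-! ### Generalized differentials, jets, regularity -/

/-- The Fréchet subdifferential `∂⁻f(x)`: the inequality
`liminf_{y → x} (f(y) - f(x) - ⟨p, y - x⟩) / |y - x| ≥ 0`, written with `ε`. -/
def frechetSubdifferential {n : ℕ} (f : Euc n → ℝ) (x : Euc n) : Set (Euc n) :=
  {p | ∀ ε > 0, ∀ᶠ y in 𝓝 x, -ε * ‖y - x‖ ≤ f y - f x - inner ℝ p (y - x)}

/-- Reachable gradients: limits of gradients `∇f(u j)` along sequences `u j → x`. -/
def reachableGradient {n : ℕ} (f : Euc n → ℝ) (x : Euc n) : Set (Euc n) :=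
  {ζ | ∃ u g : ℕ → Euc n, Tendsto u atTop (𝓝 x) ∧ (∀ j, HasGradientAt f (g j) (u j)) ∧
    Tendsto g atTop (𝓝 ζ)}

/-- The (Clarke) generalized gradient, the convex hull of the reachable gradients. -/
def clarkeGradient {n : ℕ} (f : Euc n → ℝ) (x : Euc n) : Set (Euc n) :=
  convexHull ℝ (reachableGradient f x)

/-- The second-order subjet `J^{2,-} f(x)`: pairs `(q, Q)` with `Q` symmetric and
`f(y) ≥ f(x) + ⟨q, y - x⟩ + ½ ⟨Q (y - x), y - x⟩ + o(|y - x|²)` near `x`. -/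
def subjet {n : ℕ} (f : Euc n → ℝ) (x : Euc n) : Set (Euc n × Matrix (Fin n) (Fin n) ℝ) :=
  {a | a.2.IsSymm ∧ ∃ r : Euc n → ℝ, r =o[𝓝 x] (fun y => ‖y - x‖ ^ 2) ∧
    ∀ᶠ y in 𝓝 x, f x + inner ℝ a.1 (y - x)
      + 1 / 2 * inner ℝ (Matrix.toEuclideanLin a.2 (y - x)) (y - x) + r y ≤ f y}

/-- `f` is semiconcave on `Ω`: continuous, and for some constant `c`,
`f(x + h) + f(x - h) - 2 f(x) ≤ c |h|²` whenever `[x - h, x + h] ⊆ Ω`. -/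
def SemiconcaveOn {n : ℕ} (f : Euc n → ℝ) (Ω : Set (Euc n)) : Prop :=
  ContinuousOn f Ω ∧ ∃ c : ℝ, ∀ x h, segment ℝ (x - h) (x + h) ⊆ Ω →
    f (x + h) + f (x - h) - 2 * f x ≤ c * ‖h‖ ^ 2

/-- `f` is semiconcave on an open neighbourhood of each point. -/
def LocallySemiconcave {n : ℕ} (f : Euc n → ℝ) : Prop :=
  ∀ x, ∃ Ω, IsOpen Ω ∧ x ∈ Ω ∧ SemiconcaveOn f Ω

/-- The second derivative of `h` at `z`, as a bilinear form on `ℝⁿ × ℝⁿ`. -/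
def secondDeriv {n : ℕ} (h : Euc n × Euc n → ℝ) (z : Euc n × Euc n) :
    Euc n × Euc n →L[ℝ] Euc n × Euc n →L[ℝ] ℝ :=
  fderiv ℝ (fderiv ℝ h) z

/-- `h` is of class `C^{2,1}_loc` on the open set `ℝⁿ × (ℝⁿ ∖ {0})`: it is `C²` there and its
second derivatives are locally Lipschitz there. -/
def IsC21LocOffZero {n : ℕ} (h : Euc n × Euc n → ℝ) : Prop :=
  ContDiffOn ℝ 2 h {z | z.2 ≠ 0} ∧ LocallyLipschitzOn {z | z.2 ≠ 0} (secondDeriv h)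

/-! ### Dual arcs and the Riccati equation -/

/-- `p` is a dual arc associated with `x` on `[t₀, T]`: an arc such that `x' ∈ ∂ₚ⁻H(x, p)` and
`-p' ∈ ∂ₓ⁻H(x, p)` almost everywhere, and `-p(T) ∈ ∂φ(x(T))`. -/
def IsDualArc {n : ℕ} (F : Euc n → Set (Euc n)) (φ : Euc n → ℝ) (t₀ T : ℝ)
    (x p : ℝ → Euc n) : Prop :=
  AbsolutelyContinuousOnInterval p t₀ T ∧
  (∀ᵐ s : ℝ, s ∈ Icc t₀ T →
    (∃ v ∈ frechetSubdifferential (fun q => hamiltonian F (x s, q)) (p s), HasDerivAt x v s) ∧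
    (∃ w, -w ∈ frechetSubdifferential (fun y => hamiltonian F (y, p s)) (x s) ∧
      HasDerivAt p w s)) ∧
  -p T ∈ clarkeGradient φ (x T)

variable {n : ℕ}

/-- The `i`-th standard basis vector. -/
def stdVec (i : Fin n) : Euc n := EuclideanSpace.single i 1

/-- `(H_xx)_{ij} = ∂²H / ∂x_i ∂x_j`. -/
def hessXX (h : Euc n × Euc n → ℝ) (z : Euc n × Euc n) : Matrix (Fin n) (Fin n) ℝ :=
  Matrix.of fun i j => secondDeriv h z (stdVec i, 0) (stdVec j, 0)

/-- `(H_px)_{ij} = ∂²H / ∂x_i ∂p_j`: the Jacobian of `∇ₓH` with respect to `p`. -/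
def hessPX (h : Euc n × Euc n → ℝ) (z : Euc n × Euc n) : Matrix (Fin n) (Fin n) ℝ :=
  Matrix.of fun i j => secondDeriv h z (stdVec i, 0) (0, stdVec j)

/-- `(H_xp)_{ij} = ∂²H / ∂p_i ∂x_j`: the Jacobian of `∇ₚH` with respect to `x`. -/
def hessXP (h : Euc n × Euc n → ℝ) (z : Euc n × Euc n) : Matrix (Fin n) (Fin n) ℝ :=
  Matrix.of fun i j => secondDeriv h z (0, stdVec i) (stdVec j, 0)

/-- `(H_pp)_{ij} = ∂²H / ∂p_i ∂p_j`. -/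
def hessPP (h : Euc n × Euc n → ℝ) (z : Euc n × Euc n) : Matrix (Fin n) (Fin n) ℝ :=
  Matrix.of fun i j => secondDeriv h z (0, stdVec i) (0, stdVec j)

/-- `R` solves, on `[t₀, a]`, the matrix Riccati equation
`R' + H_px[t] R + R H_xp[t] + R H_pp[t] R + H_xx[t] = 0`, `R(t₀) = R₀`, where the coefficients are
evaluated along `(x, p)`. The derivative is taken entrywise (one-sided at the end points). -/
def IsRiccatiSolution (h : Euc n × Euc n → ℝ) (x p : ℝ → Euc n) (t₀ a : ℝ)
    (R₀ : Matrix (Fin n) (Fin n) ℝ) (R : ℝ → Matrix (Fin n) (Fin n) ℝ) : Prop :=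
  R t₀ = R₀ ∧ ∀ t ∈ Icc t₀ a, ∃ R' : Matrix (Fin n) (Fin n) ℝ,
    (∀ i j, HasDerivWithinAt (fun s => R s i j) (R' i j) (Icc t₀ a) t) ∧
    R' + hessPX h (x t, p t) * R t + R t * hessXP h (x t, p t)
      + R t * hessPP h (x t, p t) * R t + hessXX h (x t, p t) = 0

end

end MayerJets

open MayerJets

open scoped NNReal

/-! ### Absolutely continuous curves -/

section AbsolutelyContinuous

/-! Since `H(x, ·)` is a supremum of linear functions, at `q ≠ 0` the gradient `∇ₚH(y, q)` is the
maximizing velocity: it lies in `F y` and `⟨∇ₚH(y, q), q⟩ = H(y, q)` (`gradSnd_hamiltonian`). Hence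
the feedback `y' = ∇ₚH(y, p + R (y - x))` produces admissible trajectories. Put `δ = y - x` and `ψ =
⟨p, δ⟩ + ½ ⟨R δ, δ⟩`. For symmetric `R` the Hamiltonian system gives `ψ' = H(x + δ, p + Rδ) - H(x,
p) - DH(x, p)(δ, Rδ) + ½ ⟨R' δ, δ⟩`, and the Riccati equation says precisely that the second-order
part vanishes (`exists_feedback`, `inner_hamiltonRiccati`). So `ψ` is constant up to `o(|δ|²)`.

To propagate a subjet from `t₀` to `t` (`subjet_propagation`), start the feedback at a point `y`
near `x t` and run it backwards to `t₀`. Dynamic programming gives `V(t₀, x₀ + δ t₀) ≤ V(t, y)`, the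
subjet at `t₀` bounds the left side below by `V(t₀, x₀) - ψ t₀ - o(|δ t₀|²)`, and `V` is constant
along `x`. Replacing `ψ t₀` by `ψ t` yields the subjet inequality at `t`; Gronwall makes `|δ t₀|`
comparable to `|y - x t|`.

For semiconcave `φ`, blow-up of `R` is excluded from both sides. The feedback with `R` replaced by
`0`, run forward to `T`, bounds `V(t, x t + d)` above by a quadratic, uniformly in `t`
(`valueFunction_le_quadratic`); compared with the propagated subjet this bounds `R` below. Convexity
of `H` in `p` makes `R H_pp R` nonnegative, so the trace of `R` grows at most linearly in itself and
bounds `R` above (`exists_norm_bound_of_riccati`). The a priori bound gives global existence by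
truncation (`exists_riccati_solution_of_bound`). -/

theorem LipschitzWith.comp_absolutelyContinuousOnInterval {X Y : Type*} [PseudoMetricSpace X]
    [PseudoMetricSpace Y] {g : X → Y} {K : ℝ≥0} (hg : LipschitzWith K g) {f : ℝ → X} {a b : ℝ}
    (hf : AbsolutelyContinuousOnInterval f a b) :
    AbsolutelyContinuousOnInterval (fun s => g (f s)) a b := by
  have h0 : Tendsto (fun E : ℕ × (ℕ → ℝ × ℝ) =>
      (K : ℝ) * ∑ i ∈ Finset.range E.1, dist (f (E.2 i).1) (f (E.2 i).2))
      (AbsolutelyContinuousOnInterval.totalLengthFilter ⊓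
        𝓟 (AbsolutelyContinuousOnInterval.disjWithin a b)) (𝓝 0) := by
    simpa using Tendsto.const_mul (K : ℝ) hf
  refine squeeze_zero (fun E => Finset.sum_nonneg fun _ _ => dist_nonneg) (fun E => ?_) h0
  rw [Finset.mul_sum]
  exact Finset.sum_le_sum fun i _ => hg.dist_le_mul _ _

theorem AbsolutelyContinuousOnInterval.of_dist_le {X : Type*} [PseudoMetricSpace X] {f : ℝ → X}
    {a b L : ℝ} (hab : a ≤ b)
    (h : ∀ s ∈ Icc a b, ∀ r ∈ Icc a b, dist (f s) (f r) ≤ L * |s - r|) :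
    AbsolutelyContinuousOnInterval f a b := by
  refine LipschitzOnWith.absolutelyContinuousOnInterval (K := L.toNNReal) ?_
  rw [uIcc_of_le hab]
  refine LipschitzOnWith.of_dist_le_mul fun s hs r hr => (h s hs r hr).trans ?_
  rw [Real.dist_eq]
  exact mul_le_mul_of_nonneg_right (Real.le_coe_toNNReal L) (abs_nonneg _)

variable {E : Type*} [NormedAddCommGroup E] [InnerProductSpace ℝ E]

/-- Pairing with `w = y b - y a` reduces to scalar functions: the fundamental theorem of calculus
for `⟨w, y⟩` gives `‖w‖² ≤ ‖w‖ ∫ φ`. -/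
theorem AbsolutelyContinuousOnInterval.norm_sub_le_integral {y : ℝ → E} {a b : ℝ} (hab : a ≤ b)
    (hy : AbsolutelyContinuousOnInterval y a b) {φ : ℝ → ℝ} (hφ : ContinuousOn φ (Icc a b))
    (h : ∀ᵐ s : ℝ, s ∈ Icc a b → ∃ v, ‖v‖ ≤ φ s ∧ HasDerivAt y v s) :
    ‖y b - y a‖ ≤ ∫ s in a..b, φ s := by
  set w := y b - y a with hw
  have hu : AbsolutelyContinuousOnInterval (fun s => innerSL ℝ w (y s)) a b :=
    (innerSL ℝ w).lipschitz.comp_absolutelyContinuousOnInterval hy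
  have h1 := hu.integral_deriv_eq_sub
  have h2 : ∫ s in a..b, deriv (fun s => innerSL ℝ w (y s)) s ≤ ∫ s in a..b, ‖w‖ * φ s := by
    refine intervalIntegral.integral_mono_ae_restrict hab hu.intervalIntegrable_deriv
      ((ContinuousOn.intervalIntegrable (by rwa [uIcc_of_le hab])).const_mul _) ?_
    rw [EventuallyLE, ae_restrict_iff' measurableSet_Icc]
    filter_upwards [h] with s hs hsI
    obtain ⟨v, hv, hd⟩ := hs hsI
    have h3 : HasDerivAt (fun s => innerSL ℝ w (y s)) (innerSL ℝ w v) s :=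
      (innerSL ℝ w).hasFDerivAt.comp_hasDerivAt s hd
    rw [h3.deriv, innerSL_apply_apply]
    exact (real_inner_le_norm _ _).trans (mul_le_mul_of_nonneg_left hv (norm_nonneg _))
  rw [h1, intervalIntegral.integral_const_mul, ← map_sub, ← hw, innerSL_apply_apply,
    real_inner_self_eq_norm_sq] at h2
  rcases eq_or_lt_of_le (norm_nonneg w) with h0 | h0
  · rw [← h0]
    refine intervalIntegral.integral_nonneg_of_ae_restrict hab ?_
    rw [EventuallyLE, ae_restrict_iff' measurableSet_Icc]
    filter_upwards [h] with s hs hsI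
    obtain ⟨v, hv, -⟩ := hs hsI
    exact (norm_nonneg _).trans hv
  · rw [pow_two] at h2
    exact le_of_mul_le_mul_left h2 h0

/-- Growth bounds for absolutely continuous curves with an affine bound on the velocity. -/
theorem AbsolutelyContinuousOnInterval.bounds_of_growth {γ : ℝ} (hγ : 0 ≤ γ) (r d : ℝ) :
    ∃ M : ℝ, ∀ (a b : ℝ), a ≤ b → b - a ≤ d → ∀ y : ℝ → E,
      AbsolutelyContinuousOnInterval y a b →
      (∀ᵐ s : ℝ, s ∈ Icc a b → ∃ v, ‖v‖ ≤ γ * (1 + ‖y s‖) ∧ HasDerivAt y v s) → ‖y a‖ ≤ r →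
      (∀ s ∈ Icc a b, ‖y s‖ ≤ M) ∧
        ∀ s ∈ Icc a b, ∀ t ∈ Icc a b, dist (y s) (y t) ≤ γ * (1 + M) * |s - t| := by
  set M := r + gronwallBound 0 γ (γ * (1 + r)) d with hM
  refine ⟨M, fun a b hab hd y hy hv hr => ?_⟩
  have hr0 : 0 ≤ r := (norm_nonneg _).trans hr
  have hyc : ContinuousOn y (Icc a b) := by simpa [uIcc_of_le hab] using hy.continuousOn
  have hφc : ContinuousOn (fun s => γ * (1 + ‖y s‖)) (Icc a b) := by fun_prop
  have hint : ∀ s ∈ Icc a b, ∀ t ∈ Icc a b, s ≤ t →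
      ‖y t - y s‖ ≤ ∫ u in s..t, γ * (1 + ‖y u‖) := fun s hs t ht hst => by
    refine AbsolutelyContinuousOnInterval.norm_sub_le_integral hst (hy.mono ?_)
      (hφc.mono (Icc_subset_Icc hs.1 ht.2)) ?_
    · rw [uIcc_of_le hst, uIcc_of_le hab]; exact Icc_subset_Icc hs.1 ht.2
    · filter_upwards [hv] with u hu hu2
      exact hu ⟨hs.1.trans hu2.1, hu2.2.trans ht.2⟩
  set φ : ℝ → ℝ := IccExtend hab (fun s => γ * (1 + ‖y s‖)) with hφ
  have hφc' : Continuous φ := by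
    refine (continuousOn_iff_continuous_domRestrict.1 hφc).Icc_extend'
  have hφe : ∀ s ∈ Icc a b, φ s = γ * (1 + ‖y s‖) := fun s hs => IccExtend_of_mem hab _ hs
  have hφ0 : ∀ s, 0 ≤ φ s := fun s => by
    simp only [hφ, IccExtend, Function.comp]; positivity
  -- Gronwall is applied to `I` rather than to `‖y‖`: it is differentiable everywhere, vanishes at
  -- `a`, dominates `‖y‖ - r`, and satisfies `I' ≤ γ I + γ (1 + r)`. This is the origin of `M`.
  set I : ℝ → ℝ := fun s => ∫ u in a..s, φ u with hI
  have hId : ∀ s, HasDerivAt I (φ s) s := fun s => hφc'.integral_hasStrictDerivAt a s |>.hasDerivAt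
  have hy1 : ∀ s ∈ Icc a b, ‖y s‖ ≤ r + I s := fun s hs => by
    have h1 := hint a ⟨le_rfl, hab⟩ s hs hs.1
    have h2 : ∫ u in a..s, γ * (1 + ‖y u‖) = I s := by
      refine intervalIntegral.integral_congr fun u hu => ?_
      rw [uIcc_of_le hs.1] at hu
      exact (hφe u ⟨hu.1, hu.2.trans hs.2⟩).symm
    have h3 := norm_le_norm_add_norm_sub' (y s) (y a)
    linarith
  have hI0 : ∀ s ∈ Icc a b, 0 ≤ I s := fun s hs =>
    intervalIntegral.integral_nonneg hs.1 fun u _ => hφ0 u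
  have hg := norm_le_gronwallBound_of_norm_deriv_right_le (f := I) (f' := φ) (δ := 0) (K := γ)
    (ε := γ * (1 + r)) (a := a) (b := b) (fun s _ => (hId s).continuousAt.continuousWithinAt)
    (fun s _ => (hId s).hasDerivWithinAt) (by simp [hI]) (fun s hs => by
      have hs' := Ico_subset_Icc_self hs
      rw [Real.norm_of_nonneg (hφ0 s), Real.norm_of_nonneg (hI0 s hs'), hφe s hs']
      nlinarith [hy1 s hs'])
  have hyM : ∀ s ∈ Icc a b, ‖y s‖ ≤ M := fun s hs => by
    have h1 := hg s hs
    rw [Real.norm_of_nonneg (hI0 s hs)] at h1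
    have h2 : gronwallBound 0 γ (γ * (1 + r)) (s - a) ≤ gronwallBound 0 γ (γ * (1 + r)) d :=
      gronwallBound_mono le_rfl (by positivity) hγ (by linarith [hs.2])
    linarith [hy1 s hs]
  have hlip : ∀ s ∈ Icc a b, ∀ t ∈ Icc a b, s ≤ t →
      dist (y s) (y t) ≤ γ * (1 + M) * |s - t| := fun s hs t ht hst => by
    rw [dist_comm, dist_eq_norm, abs_sub_comm, abs_of_nonneg (sub_nonneg.2 hst)]
    refine (hint s hs t ht hst).trans ?_
    have h1 : ∫ u in s..t, γ * (1 + ‖y u‖) ≤ ∫ _ in s..t, γ * (1 + M) := by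
      have hsub := Icc_subset_Icc hs.1 ht.2
      refine intervalIntegral.integral_mono_on hst ?_ (by simp) fun u hu => ?_
      · exact ContinuousOn.intervalIntegrable (by rw [uIcc_of_le hst]; exact hφc.mono hsub)
      · have := hyM u (hsub hu)
        gcongr
    rw [intervalIntegral.integral_const, smul_eq_mul, mul_comm] at h1
    exact h1
  refine ⟨hyM, fun s hs t ht => ?_⟩
  rcases le_total s t with h | h
  · exact hlip s hs t ht h
  · rw [dist_comm, abs_sub_comm]; exact hlip t ht s hs h

/-- An absolutely continuous curve whose derivative agrees almost everywhere with a continuous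
function is continuously differentiable. -/
theorem AbsolutelyContinuousOnInterval.hasDerivWithinAt_of_ae [CompleteSpace E] {y g : ℝ → E}
    {a b : ℝ} (hab : a ≤ b) (hy : AbsolutelyContinuousOnInterval y a b)
    (hg : ContinuousOn g (Icc a b)) (h : ∀ᵐ s : ℝ, s ∈ Icc a b → HasDerivAt y (g s) s) :
    ∀ s ∈ Icc a b, HasDerivWithinAt y (g s) (Icc a b) s := by
  set G : ℝ → E := IccExtend hab (fun s => g s) with hG
  have hGc : Continuous G := (continuousOn_iff_continuous_domRestrict.1 hg).Icc_extend'
  have hGe : ∀ s ∈ Icc a b, G s = g s := fun s hs => IccExtend_of_mem hab _ hs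
  set I : ℝ → E := fun s => ∫ u in a..s, G u with hI
  have hId : ∀ s, HasDerivAt I (G s) s := fun s => hGc.integral_hasStrictDerivAt a s |>.hasDerivAt
  have hIac : AbsolutelyContinuousOnInterval I a b := by
    refine ContDiffOn.absolutelyContinuousOnInterval (ContDiff.contDiffOn ?_)
    rw [contDiff_one_iff_deriv]
    refine ⟨fun s => (hId s).differentiableAt, ?_⟩
    rwa [show deriv I = G from funext fun s => (hId s).deriv]
  -- `y - I` is absolutely continuous with derivative zero almost everywhere, hence constant.
  obtain ⟨C, hC⟩ := (hy.sub hIac).const_of_ae_hasDerivAt_zero (by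
    rw [uIcc_of_le hab]
    filter_upwards [h] with s hs hsI
    have := (hs hsI).sub (hId s)
    rwa [hGe s hsI, sub_self] at this)
  rw [uIcc_of_le hab] at hC
  have he : ∀ s ∈ Icc a b, y s = C + I s := fun s hs => by
    have := hC s hs
    simp only [Pi.sub_apply] at this
    rw [← this]; abel
  intro s hs
  rw [← hGe s hs]
  exact ((hId s).const_add C).hasDerivWithinAt.congr he (he s hs)

end AbsolutelyContinuous

/-! ### Ordinary differential equations -/

section ODE

variable {E : Type*} [NormedAddCommGroup E] [NormedSpace ℝ E]

/-- A field bounded by `B` moves a solution by at most `B (b - a)`; with a ball of that radius,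
Picard–Lindelöf covers the whole interval at once. -/
theorem exists_solution_of_bounded_lipschitz [CompleteSpace E] {f : ℝ → E → E} {a b B : ℝ}
    {K : ℝ≥0} (hlip : ∀ s ∈ Icc a b, LipschitzWith K (f s))
    (hc : ∀ y, ContinuousOn (fun s => f s y) (Icc a b)) (hB : ∀ s ∈ Icc a b, ∀ y, ‖f s y‖ ≤ B)
    {s₁ : ℝ} (hs₁ : s₁ ∈ Icc a b) (y₁ : E) :
    ∃ y : ℝ → E, y s₁ = y₁ ∧ ∀ s ∈ Icc a b, HasDerivWithinAt y (f s (y s)) (Icc a b) s := by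
  have hB0 : 0 ≤ B := (norm_nonneg _).trans (hB s₁ hs₁ 0)
  have hpl : IsPicardLindelof f (tmin := a) (tmax := b) ⟨s₁, hs₁⟩ y₁
      (B.toNNReal * (b - a).toNNReal) 0 B.toNNReal K :=
    { lipschitzOnWith := fun t ht => (hlip t ht).lipschitzOnWith
      continuousOn := fun y _ => hc y
      norm_le := fun t ht y _ => (hB t ht y).trans (Real.le_coe_toNNReal B)
      mul_max_le := by
        have h1 : 0 ≤ b - a := by linarith [hs₁.1, hs₁.2]
        simp only [NNReal.coe_mul, Real.coe_toNNReal _ hB0, Real.coe_toNNReal _ h1, NNReal.coe_zero,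
          sub_zero]
        exact mul_le_mul_of_nonneg_left
          (max_le (by linarith [hs₁.1]) (by linarith [hs₁.2])) hB0 }
  exact hpl.exists_eq_forall_mem_Icc_hasDerivWithinAt₀

theorem HasDerivWithinAt.Ici_of_Icc {y : ℝ → E} {y' : E} {a b s : ℝ} (hs : s ∈ Ico a b)
    (h : HasDerivWithinAt y y' (Icc a b) s) : HasDerivWithinAt y y' (Ici s) s :=
  h.mono_of_mem_nhdsWithin (mem_of_superset (Icc_mem_nhdsGE hs.2) (Icc_subset_Icc_left hs.1))

/-- Gronwall in both time directions, the past being handled by reversing time. Feedback curves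
start at an interior time and are followed back to `t₀` as well as forward to `T`. -/
theorem norm_le_mul_exp_of_norm_deriv_le {y y' : ℝ → E} {a b K : ℝ} (hK : 0 ≤ K)
    (hy : ∀ s ∈ Icc a b, HasDerivWithinAt y (y' s) (Icc a b) s)
    (h : ∀ s ∈ Icc a b, ‖y' s‖ ≤ K * ‖y s‖) {s₁ : ℝ} (hs₁ : s₁ ∈ Icc a b) :
    ∀ s ∈ Icc a b, ‖y s‖ ≤ ‖y s₁‖ * Real.exp (K * (b - a)) := by
  have key : ∀ {z z' : ℝ → E} {c d : ℝ}, d - c ≤ b - a →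
      (∀ s ∈ Icc c d, HasDerivWithinAt z (z' s) (Icc c d) s) →
      (∀ s ∈ Icc c d, ‖z' s‖ ≤ K * ‖z s‖) →
      ∀ s ∈ Icc c d, ‖z s‖ ≤ ‖z c‖ * Real.exp (K * (b - a)) := by
    intro z z' c d hcd hz hz' s hs
    have := norm_le_gronwallBound_of_norm_deriv_right_le (f := z) (f' := z') (δ := ‖z c‖) (K := K)
      (ε := 0) (a := c) (b := d) (fun s hs => (hz s hs).continuousWithinAt)
      (fun s hs => (hz s (Ico_subset_Icc_self hs)).Ici_of_Icc hs) le_rfl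
      (fun s hs => by simpa using hz' s (Ico_subset_Icc_self hs)) s hs
    rw [gronwallBound_ε0] at this
    refine this.trans (mul_le_mul_of_nonneg_left (Real.exp_le_exp.2 ?_) (norm_nonneg _))
    exact mul_le_mul_of_nonneg_left (by linarith [hs.2]) hK
  intro s hs
  rcases le_total s₁ s with hle | hle
  · have hsub : Icc s₁ b ⊆ Icc a b := Icc_subset_Icc_left hs₁.1
    exact key (by linarith [hs₁.1]) (fun u hu => (hy u (hsub hu)).mono hsub)
      (fun u hu => h u (hsub hu)) s ⟨hle, hs.2⟩
  · have hmem : ∀ u ∈ Icc (-s₁) (-a), -u ∈ Icc a b := fun u hu =>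
      ⟨by linarith [hu.2], by linarith [hu.1, hs₁.2]⟩
    have := key (z := fun u => y (-u)) (z' := fun u => -y' (-u)) (c := -s₁) (d := -a)
      (by linarith [hs₁.2])
      (fun u hu => by
        have h1 := HasDerivWithinAt.scomp (g₁ := y) (g₁' := y' (-u)) (t' := Icc a b) u
          (hy (-u) (hmem u hu)) ((hasDerivAt_neg u).hasDerivWithinAt (s := Icc (-s₁) (-a))) hmem
        simpa [Function.comp_def] using h1)
      (fun u hu => by simpa using h (-u) (hmem u hu)) (-s) ⟨by linarith, by linarith [hs.1]⟩
    simpa using this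

/-- A Lipschitz cut-off of the identity with values in a ball. -/
theorem exists_cutoff_id [FiniteDimensional ℝ E] {ρ : ℝ} (hρ : 0 < ρ) :
    ∃ (χ : E → E) (K : ℝ≥0), LipschitzWith K χ ∧ (∀ y, ‖χ y‖ ≤ ρ) ∧ (∀ y, ‖χ y‖ ≤ ‖y‖) ∧
      ∀ y, ‖y‖ ≤ ρ / 2 → χ y = y := by
  let β : ContDiffBump (0 : E) := ⟨ρ / 2, ρ, by positivity, by linarith⟩
  have hd : ContDiff ℝ 1 (fun y : E => β y • y) := β.contDiff.smul contDiff_id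
  have hle : ∀ y : E, ‖β y • y‖ ≤ ‖y‖ := fun y => by
    rw [norm_smul, Real.norm_of_nonneg β.nonneg]
    exact mul_le_of_le_one_left (norm_nonneg _) β.le_one
  obtain ⟨K, hK⟩ := ContDiff.lipschitzWith_of_hasCompactSupport (𝕂 := ℝ)
    (β.hasCompactSupport.smul_right (f' := fun y : E => y)) hd one_ne_zero
  refine ⟨fun y => β y • y, K, hK, fun y => ?_, hle, fun y hy => ?_⟩
  · by_cases hy : ‖y‖ ≤ ρ
    · exact (hle y).trans hy
    · have : β y = 0 := β.zero_of_le_dist (by simpa using (not_le.1 hy).le)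
      simp [this, hρ.le]
  · have : β y = 1 := β.one_of_mem_closedBall (by simpa using hy)
    simp [this]

/-- Solutions near an equilibrium of a field which is Lipschitz near the equilibrium. -/
theorem exists_solution_near_zero [FiniteDimensional ℝ E] {f : ℝ → E → E} {a b ρ : ℝ} (hρ : 0 < ρ)
    {K : ℝ≥0} (hlip : ∀ s ∈ Icc a b, LipschitzOnWith K (f s) (Metric.closedBall 0 ρ))
    (hc : ∀ y ∈ Metric.closedBall (0 : E) ρ, ContinuousOn (fun s => f s y) (Icc a b))
    (h0 : ∀ s ∈ Icc a b, f s 0 = 0) :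
    ∃ C > 0, ∃ r > 0, ∀ s₁ ∈ Icc a b, ∀ y₁ : E, ‖y₁‖ ≤ r → ∃ y : ℝ → E, y s₁ = y₁ ∧
      (∀ s ∈ Icc a b, HasDerivWithinAt y (f s (y s)) (Icc a b) s) ∧
      (∀ s ∈ Icc a b, ‖y s‖ ≤ C * ‖y₁‖) ∧ ∀ s ∈ Icc a b, ‖y s‖ ≤ ρ := by
  have : CompleteSpace E := FiniteDimensional.complete ℝ E
  obtain ⟨χ, K', hχ, hχρ, hχle, hχe⟩ := exists_cutoff_id (E := E) hρ
  have hmem : ∀ y, χ y ∈ Metric.closedBall (0 : E) ρ := fun y => by simpa using hχρ y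
  have hle : ∀ s ∈ Icc a b, ∀ y, ‖f s (χ y)‖ ≤ K * ‖χ y‖ := fun s hs y => by
    have := (hlip s hs).dist_le_mul _ (hmem y) 0 (by simp [hρ.le])
    simpa [h0 s hs] using this
  -- `C` is the Gronwall factor; `r` is chosen so that solutions of the truncated equation stay in
  -- the ball of radius `ρ / 2`, where the cut-off is the identity.
  refine ⟨Real.exp (K * (b - a)), Real.exp_pos _, ρ / 2 / Real.exp (K * (b - a)), by positivity,
    fun s₁ hs₁ y₁ hy₁ => ?_⟩
  obtain ⟨y, hy1, hy⟩ := exists_solution_of_bounded_lipschitz (f := fun s y => f s (χ y))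
    (a := a) (b := b) (B := K * ρ) (K := K * K')
    (fun s hs => LipschitzWith.of_dist_le_mul fun u v => by
      refine ((hlip s hs).dist_le_mul _ (hmem u) _ (hmem v)).trans ?_
      rw [NNReal.coe_mul, mul_assoc]
      exact mul_le_mul_of_nonneg_left (hχ.dist_le_mul u v) K.2)
    (fun y => hc _ (hmem y))
    (fun s hs y => (hle s hs y).trans (mul_le_mul_of_nonneg_left (hχρ y) K.2)) hs₁ y₁
  have hb := norm_le_mul_exp_of_norm_deriv_le K.2 hy (fun s hs =>
    (hle s hs _).trans (mul_le_mul_of_nonneg_left (hχle _) K.2)) hs₁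
  rw [hy1] at hb
  have hb2 : ∀ s ∈ Icc a b, ‖y s‖ ≤ ρ / 2 := fun s hs =>
    (hb s hs).trans (by rwa [le_div_iff₀ (Real.exp_pos _)] at hy₁)
  refine ⟨y, hy1, fun s hs => ?_, fun s hs => ?_, fun s hs => (hb2 s hs).trans (by linarith)⟩
  · have := hy s hs
    rwa [hχe _ (hb2 s hs)] at this
  · rw [mul_comm]; exact hb s hs

end ODE

/-! ### Taylor expansion, uniformly on compact sets -/

section Taylor

theorem IsCompact.exists_norm_add_sub_le {E F : Type*} [NormedAddCommGroup E]
    [NormedAddCommGroup F] {f : E → F} {K : Set E}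
    (hK : IsCompact K) (hf : ∀ z ∈ K, ContinuousAt f z) {ε : ℝ} (hε : 0 < ε) :
    ∃ r > 0, ∀ z ∈ K, ∀ v : E, ‖v‖ < r → ‖f (z + v) - f z‖ ≤ ε := by
  have hu := hK.uniformContinuousAt_of_continuousAt f hf (Metric.dist_mem_uniformity hε)
  obtain ⟨r, hr, h⟩ := Metric.mem_uniformity_dist.1 hu
  refine ⟨r, hr, fun z hz v hv => ?_⟩
  have := @h z (z + v) (by simpa [dist_eq_norm] using hv) hz
  rw [mem_ofPred_eq, dist_comm, dist_eq_norm] at this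
  exact this.le

variable {E : Type*} [NormedAddCommGroup E] [NormedSpace ℝ E]

/-- The mean value inequality is used twice: for the first-order remainder of `fderiv ℝ h`, whose
derivative is small by continuity of the second derivative, and then for the second-order remainder
of `h`. Compactness makes `r` uniform, as is needed along an entire extremal. -/
theorem IsCompact.exists_taylor_two {h : E → ℝ} {U K : Set E} (hU : IsOpen U) (hK : IsCompact K)
    (hKU : K ⊆ U) (hh : ContDiffOn ℝ 2 h U) {ε : ℝ} (hε : 0 < ε) :
    ∃ r > 0, ∀ z ∈ K, ∀ w : E, ‖w‖ ≤ r →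
      |h (z + w) - h z - fderiv ℝ h z w - 1 / 2 * fderiv ℝ (fderiv ℝ h) z w w| ≤ ε * ‖w‖ ^ 2 := by
  have hd1 : ∀ z ∈ U, DifferentiableAt ℝ h z := fun z hz =>
    ((hh z hz).contDiffAt (hU.mem_nhds hz)).differentiableAt two_ne_zero
  have hD : ContDiffOn ℝ 1 (fderiv ℝ h) U := hh.fderiv_of_isOpen hU (by norm_num)
  have hd2 : ∀ z ∈ U, DifferentiableAt ℝ (fderiv ℝ h) z := fun z hz =>
    ((hD z hz).contDiffAt (hU.mem_nhds hz)).differentiableAt one_ne_zero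
  have hc2 : ∀ z ∈ U, ContinuousAt (fderiv ℝ (fderiv ℝ h)) z := fun z hz =>
    (hD.continuousOn_fderiv_of_isOpen hU le_rfl).continuousAt (hU.mem_nhds hz)
  obtain ⟨r₁, hr₁, h₁⟩ := hK.exists_norm_add_sub_le
    (F := E →L[ℝ] E →L[ℝ] ℝ) (fun z hz => hc2 z (hKU hz)) hε
  obtain ⟨r₂, hr₂, h₂⟩ := hK.exists_thickening_subset_open hU hKU
  refine ⟨min r₁ r₂ / 2, by positivity, fun z hz w hw => ?_⟩
  have hmin : 0 < min r₁ r₂ := by positivity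
  have hball : ∀ v : E, ‖v‖ ≤ ‖w‖ → z + v ∈ U ∧
      ‖fderiv ℝ (fderiv ℝ h) (z + v) - fderiv ℝ (fderiv ℝ h) z‖ ≤ ε := fun v hv => by
    have hv1 : ‖v‖ < min r₁ r₂ := by linarith
    refine ⟨h₂ (Metric.mem_thickening_iff.2 ⟨z, hz, ?_⟩), ?_⟩
    · simpa [dist_eq_norm] using hv1.trans_le (min_le_right _ _)
    · exact h₁ z hz v (hv1.trans_le (min_le_left _ _))
  set D := fderiv ℝ h z with hDdef
  set D2 := fderiv ℝ (fderiv ℝ h) z with hD2def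
  have hsymm : ∀ u v, D2 u v = D2 v u := fun u v =>
    (((hh z (hKU hz)).contDiffAt (hU.mem_nhds (hKU hz))).isSymmSndFDerivAt (by simp)) u v
  have hconv : Convex ℝ (Metric.closedBall (0 : E) ‖w‖) := convex_closedBall _ _
  have step1 : ∀ v : E, ‖v‖ ≤ ‖w‖ → ‖fderiv ℝ h (z + v) - D - D2 v‖ ≤ ε * ‖w‖ := fun v hv => by
    have := hconv.norm_image_sub_le_of_norm_hasFDerivWithin_le
      (f := fun v => fderiv ℝ h (z + v) - D - D2 v)
      (f' := fun v => fderiv ℝ (fderiv ℝ h) (z + v) - D2) (C := ε) (x := 0) (y := v)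
      (fun u hu => by
        have hu' := (hball u (by simpa using hu)).1
        have h3 : HasFDerivAt (fun v => fderiv ℝ h (z + v)) (fderiv ℝ (fderiv ℝ h) (z + u)) u := by
          rw [hasFDerivAt_comp_add_left]
          exact (hd2 _ hu').hasFDerivAt
        exact ((h3.sub_const D).sub D2.hasFDerivAt).hasFDerivWithinAt)
      (fun u hu => (hball u (by simpa using hu)).2) (by simp) (by simpa using hv)
    simp only [add_zero, map_zero, sub_zero, ← hDdef, sub_self] at this
    exact this.trans (mul_le_mul_of_nonneg_left hv hε.le)
  have := hconv.norm_image_sub_le_of_norm_hasFDerivWithin_le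
      (f := fun v => h (z + v) - D v - 1 / 2 * D2 v v)
      (f' := fun v => fderiv ℝ h (z + v) - D - D2 v) (C := ε * ‖w‖) (x := 0) (y := w)
      (fun u hu => by
        have hu' := (hball u (by simpa using hu)).1
        have h3 : HasFDerivAt (fun v => h (z + v)) (fderiv ℝ h (z + u)) u := by
          rw [hasFDerivAt_comp_add_left]
          exact (hd1 _ hu').hasFDerivAt
        have h4 : HasFDerivAt (fun v => D2 v v) (D2 u + D2.flip u) u :=
          (D2.hasFDerivAt.clm_apply (hasFDerivAt_id u)).congr_fderiv (by ext k; simp)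
        refine (((h3.sub D.hasFDerivAt).sub (h4.const_mul (1 / 2 : ℝ))).congr_fderiv
          ?_).hasFDerivWithinAt
        ext k
        simp [hsymm k u]
        ring)
      (fun u hu => step1 u (by simpa using hu)) (by simp) (by simp)
  simp only [add_zero, map_zero, sub_zero, mul_zero] at this
  rw [Real.norm_eq_abs] at this
  calc _ = |h (z + w) - D w - 1 / 2 * D2 w w - h z| := by congr 1; ring
    _ ≤ _ := this
    _ = _ := by ring

end Taylor

/-! ### Subjets and semiconcave functions -/

section Jets

variable {n : ℕ}

theorem mem_subjet_iff {f : Euc n → ℝ} {x q : Euc n} {Q : Matrix (Fin n) (Fin n) ℝ} :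
    (q, Q) ∈ subjet f x ↔ Q.IsSymm ∧ ∀ ε > 0, ∀ᶠ y in 𝓝 x, f x + inner ℝ q (y - x)
      + 1 / 2 * inner ℝ (Matrix.toEuclideanCLM (𝕜 := ℝ) Q (y - x)) (y - x) - ε * ‖y - x‖ ^ 2
        ≤ f y := by
  have hQ : ∀ v, Matrix.toEuclideanCLM (𝕜 := ℝ) Q v = Matrix.toEuclideanLin Q v := fun v => by
    rw [← Matrix.coe_toEuclideanCLM_eq_toEuclideanLin]; rfl
  simp only [hQ, subjet, mem_ofPred_eq]
  refine and_congr_right fun _ => ⟨?_, fun h => ?_⟩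
  · rintro ⟨r, hr, h⟩ ε hε
    filter_upwards [h, hr.bound hε] with y hy hry
    rw [Real.norm_eq_abs, Real.norm_of_nonneg (by positivity)] at hry
    linarith [neg_abs_le (r y)]
  -- The remainder is minus the negative part of the defect in the quadratic inequality.
  · refine ⟨fun y => min 0 (f y - (f x + inner ℝ q (y - x)
      + 1 / 2 * inner ℝ (Matrix.toEuclideanLin Q (y - x)) (y - x))), ?_, ?_⟩
    · refine Asymptotics.isLittleO_iff.2 fun ε hε => ?_
      filter_upwards [h ε hε] with y hy
      rw [Real.norm_eq_abs, abs_of_nonpos (min_le_left _ _), Real.norm_of_nonneg (by positivity),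
        neg_le, le_min_iff]
      constructor
      · have : 0 ≤ ε * ‖y - x‖ ^ 2 := by positivity
        linarith
      · linarith
    · filter_upwards with y
      linarith [min_le_right 0 (f y - (f x + inner ℝ q (y - x)
        + 1 / 2 * inner ℝ (Matrix.toEuclideanLin Q (y - x)) (y - x)))]

/-- A Fréchet subgradient of a differentiable function is the derivative. -/
theorem eq_of_mem_frechetSubdifferential {f : Euc n → ℝ} {x v : Euc n} {f' : Euc n →L[ℝ] ℝ}
    (hf : HasFDerivAt f f' x) (hv : v ∈ frechetSubdifferential f x) (k : Euc n) :
    inner ℝ v k = f' k := by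
  have key : ∀ k : Euc n, inner ℝ v k ≤ f' k := by
    intro k
    refine le_of_forall_pos_le_add fun ε hε => ?_
    -- One error `η ‖k‖` comes from the subgradient inequality and one from differentiability.
    set η := ε / (2 * (‖k‖ + 1)) with hη
    have hη0 : 0 < η := by positivity
    have h1 := (hv η hη0).and ((hasFDerivAt_iff_isLittleO.1 hf).bound hη0)
    have ht : Tendsto (fun t : ℝ => x + t • k) (𝓝[>] 0) (𝓝 x) := by
      have : Tendsto (fun t : ℝ => x + t • k) (𝓝 0) (𝓝 (x + (0 : ℝ) • k)) := by
        apply Continuous.tendsto; fun_prop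
      rw [zero_smul, add_zero] at this
      exact this.mono_left nhdsWithin_le_nhds
    obtain ⟨t, ⟨h2, h3⟩, ht0⟩ := ((ht.eventually h1).and self_mem_nhdsWithin).exists
    have ht0' : 0 < t := ht0
    simp only [add_sub_cancel_left, norm_smul, inner_smul_right, map_smul, smul_eq_mul,
      Real.norm_eq_abs, abs_of_pos ht0'] at h2 h3
    have h4 : t * inner ℝ v k ≤ t * (f' k + 2 * η * ‖k‖) := by
      nlinarith [le_abs_self (f (x + t • k) - f x - t * f' k)]
    have h5 := le_of_mul_le_mul_left h4 ht0'
    have h6 : 2 * η * ‖k‖ ≤ ε := by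
      have : 2 * η * (‖k‖ + 1) = ε := by rw [hη]; field_simp
      nlinarith
    linarith
  refine le_antisymm (key k) ?_
  have := key (-k)
  simp only [inner_neg_right, map_neg] at this
  linarith

/-- Elements of the generalized gradient of a semiconcave function satisfy a quadratic
supergradient inequality. -/
theorem MayerJets.LocallySemiconcave.le_of_mem_clarkeGradient {φ : Euc n → ℝ} (hφ : LocallySemiconcave φ)
    {x ζ : Euc n} (hζ : ζ ∈ clarkeGradient φ x) :
    ∃ c > 0, ∃ r > 0, ∀ z, ‖z - x‖ < r → φ z ≤ φ x + inner ℝ ζ (z - x) + c * ‖z - x‖ ^ 2 := by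
  obtain ⟨Ω, hΩ, hxΩ, hcont, c, hc⟩ := hφ x
  obtain ⟨r, hr, hrΩ⟩ := Metric.isOpen_iff.1 hΩ x hxΩ
  -- At a point `u` of differentiability, semiconcavity at midpoints compares the difference
  -- quotients for steps `2⁻ᵏ` and `2⁻ᵏ⁻¹`. The errors form a geometric series, and the quotients
  -- tend to `⟨g, d⟩`.
  have key : ∀ u ∈ Metric.ball x r, ∀ z ∈ Metric.ball x r, ∀ g, HasGradientAt φ g u →
      φ z ≤ φ u + inner ℝ g (z - u) + c / 2 * ‖z - u‖ ^ 2 := by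
    intro u hu z hz g hg
    set d := z - u with hd
    set e : ℕ → ℝ := fun k => (1 / 2 : ℝ) ^ k with he
    have he0 : ∀ k, 0 < e k := fun k => by positivity
    have he1 : ∀ k, e k ≤ 1 := fun k => pow_le_one₀ (by norm_num) (by norm_num)
    have hes : ∀ k, e (k + 1) = e k / 2 := fun k => by simp only [he, pow_succ]; ring
    have hball : ∀ s : ℝ, 0 ≤ s → s ≤ 1 → u + s • d ∈ Metric.ball x r := fun s h0 h1 =>
      (convex_ball x r).add_smul_sub_mem hu hz ⟨h0, h1⟩
    have hstep : ∀ k, (e k)⁻¹ * (φ (u + e k • d) - φ u) + c / 2 * ‖d‖ ^ 2 * e k ≤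
        (e (k + 1))⁻¹ * (φ (u + e (k + 1) • d) - φ u) + c / 2 * ‖d‖ ^ 2 * e (k + 1) +
          c / 2 * ‖d‖ ^ 2 * e k := by
      intro k
      have hm : u + e (k + 1) • d + e (k + 1) • d = u + e k • d := by
        rw [add_assoc, ← add_smul, hes]; congr 2; ring
      have hm2 : u + e (k + 1) • d - e (k + 1) • d = u := by abel
      have h := hc (u + e (k + 1) • d) (e (k + 1) • d) (by
        rw [hm, hm2]
        refine ((convex_ball x r).segment_subset hu (hball _ (he0 k).le (he1 k))).trans hrΩ)
      rw [hm, hm2, norm_smul, Real.norm_of_nonneg (he0 _).le, mul_pow, hes] at h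
      rw [hes, inv_div]
      have h0 := he0 k
      rw [show (2 / e k) = 2 * (e k)⁻¹ by ring]
      have h2 := mul_le_mul_of_nonneg_left h (inv_pos.2 h0).le
      have h3 : (e k)⁻¹ * (c * ((e k / 2) ^ 2 * ‖d‖ ^ 2)) = c / 4 * ‖d‖ ^ 2 * e k := by
        field_simp; ring
      rw [h3] at h2
      linarith
    have hall : ∀ k, φ (u + d) - φ u - c / 2 * ‖d‖ ^ 2 ≤
        (e k)⁻¹ * (φ (u + e k • d) - φ u) - c / 2 * ‖d‖ ^ 2 * e k := by
      intro k
      induction k with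
      | zero => simp [he]
      | succ k ih =>
        have := hstep k
        have h2 := hes k
        rw [h2] at this ⊢
        linarith
    have hd1 : HasDerivAt (fun s : ℝ => φ (u + s • d)) (inner ℝ g d) 0 := by
      have h1 : HasDerivAt (fun s : ℝ => u + s • d) d 0 := by
        simpa using ((hasDerivAt_id (0 : ℝ)).smul_const d).const_add u
      have h2 : HasFDerivAt φ (InnerProductSpace.toDual ℝ (Euc n) g) (u + (0 : ℝ) • d) := by
        rw [zero_smul, add_zero]; exact hg.hasFDerivAt
      exact h2.comp_hasDerivAt 0 h1
    have hetend : Tendsto e atTop (𝓝 0) :=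
      tendsto_pow_atTop_nhds_zero_of_lt_one (by norm_num) (by norm_num)
    have hlim : Tendsto (fun k => (e k)⁻¹ * (φ (u + e k • d) - φ u)) atTop (𝓝 (inner ℝ g d)) := by
      have h1 := hasDerivAt_iff_tendsto_slope.1 hd1
      have h2 : Tendsto e atTop (𝓝[≠] 0) := tendsto_nhdsWithin_iff.2
        ⟨hetend, Eventually.of_forall fun k => (he0 k).ne'⟩
      refine (h1.comp h2).congr fun k => ?_
      simp [slope, Function.comp]
    have hlim2 : Tendsto (fun k => (e k)⁻¹ * (φ (u + e k • d) - φ u) - c / 2 * ‖d‖ ^ 2 * e k)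
        atTop (𝓝 (inner ℝ g d - c / 2 * ‖d‖ ^ 2 * 0)) := hlim.sub (hetend.const_mul _)
    have h3 := ge_of_tendsto' hlim2 hall
    have h4 : u + d = z := by rw [hd]; abel
    rw [h4] at h3
    linarith
  -- The inequality is affine in `ζ` and survives limits, so it passes from gradients to reachable
  -- gradients and then to their convex hull.
  have hconv : Convex ℝ {ζ : Euc n | ∀ z ∈ Metric.ball x r,
      φ z ≤ φ x + inner ℝ ζ (z - x) + c / 2 * ‖z - x‖ ^ 2} := by
    intro ζ₁ h₁ ζ₂ h₂ a b ha hb hab z hz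
    rw [inner_add_left, real_inner_smul_left, real_inner_smul_left]
    have e1 := mul_le_mul_of_nonneg_left (h₁ z hz) ha
    have e2 := mul_le_mul_of_nonneg_left (h₂ z hz) hb
    have e3 : b = 1 - a := by linarith
    subst e3
    linarith
  have hsub : clarkeGradient φ x ⊆ {ζ : Euc n | ∀ z ∈ Metric.ball x r,
      φ z ≤ φ x + inner ℝ ζ (z - x) + c / 2 * ‖z - x‖ ^ 2} := by
    refine convexHull_min ?_ hconv
    rintro ζ ⟨u, g, hu, hg, hgζ⟩ z hz
    have hφu : Tendsto (fun j => φ (u j)) atTop (𝓝 (φ x)) :=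
      ((hcont.continuousAt (hΩ.mem_nhds hxΩ)).tendsto).comp hu
    have hzu : Tendsto (fun j => z - u j) atTop (𝓝 (z - x)) := hu.const_sub z
    refine ge_of_tendsto ((hφu.add (hgζ.inner hzu)).add ((hzu.norm.pow 2).const_mul (c / 2))) ?_
    filter_upwards [hu (Metric.ball_mem_nhds x hr)] with j hj
    exact key (u j) hj z hz (g j) (hg j)
  refine ⟨max (c / 2) 1, by positivity, r, hr, fun z hz => ?_⟩
  refine (hsub hζ z (by simpa [dist_eq_norm] using hz)).trans ?_
  gcongr
  exact le_max_left _ _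

end Jets

/-! ### The Hamiltonian -/

section Hamiltonian

variable {n : ℕ}

theorem isOpen_snd_ne_zero : IsOpen {z : Euc n × Euc n | z.2 ≠ 0} :=
  isOpen_ne_fun continuous_snd continuous_const

theorem MayerJets.StandingHypothesis.inner_le_hamiltonian {F : Euc n → Set (Euc n)}
    (hF : StandingHypothesis F) {x v : Euc n} (hv : v ∈ F x) (p : Euc n) :
    inner ℝ v p ≤ hamiltonian F (x, p) := by
  refine le_csSup ?_ (mem_image_of_mem _ hv)
  exact ((hF.isCompact x).image (by fun_prop)).bddAbove

theorem MayerJets.StandingHypothesis.exists_inner_eq_hamiltonian {F : Euc n → Set (Euc n)}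
    (hF : StandingHypothesis F) (x p : Euc n) : ∃ v ∈ F x, inner ℝ v p = hamiltonian F (x, p) := by
  obtain ⟨v, hv, h⟩ := (hF.isCompact x).exists_sSup_image_eq (f := fun v : Euc n => inner ℝ v p)
    (hF.nonempty x) (by fun_prop)
  exact ⟨v, hv, h.symm⟩

/-- The partial gradient of `h` with respect to the second variable. -/
noncomputable def gradSnd (h : Euc n × Euc n → ℝ) (z : Euc n × Euc n) : Euc n :=
  (InnerProductSpace.toDual ℝ (Euc n)).symm
    ((fderiv ℝ h z).comp (ContinuousLinearMap.inr ℝ (Euc n) (Euc n)))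

/-- The partial gradient of `h` with respect to the first variable. -/
noncomputable def gradFst (h : Euc n × Euc n → ℝ) (z : Euc n × Euc n) : Euc n :=
  (InnerProductSpace.toDual ℝ (Euc n)).symm
    ((fderiv ℝ h z).comp (ContinuousLinearMap.inl ℝ (Euc n) (Euc n)))

theorem inner_gradSnd (h : Euc n × Euc n → ℝ) (z : Euc n × Euc n) (v : Euc n) :
    inner ℝ (gradSnd h z) v = fderiv ℝ h z (0, v) := by
  rw [gradSnd, InnerProductSpace.toDual_symm_apply]; simp

theorem inner_gradFst (h : Euc n × Euc n → ℝ) (z : Euc n × Euc n) (v : Euc n) :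
    inner ℝ (gradFst h z) v = fderiv ℝ h z (v, 0) := by
  rw [gradFst, InnerProductSpace.toDual_symm_apply]; simp

variable {h : Euc n × Euc n → ℝ}

theorem contDiffOn_gradSnd (hh : ContDiffOn ℝ 2 h {z | z.2 ≠ 0}) :
    ContDiffOn ℝ 1 (gradSnd h) {z | z.2 ≠ 0} := by
  have hD : ContDiffOn ℝ 1 (fderiv ℝ h) {z | z.2 ≠ 0} :=
    hh.fderiv_of_isOpen isOpen_snd_ne_zero (by norm_num)
  exact (InnerProductSpace.toDual ℝ (Euc n)).symm.toContinuousLinearEquiv.contDiff.comp_contDiffOn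
    (hD.clm_comp contDiffOn_const)

theorem continuousOn_gradFst (hh : ContDiffOn ℝ 2 h {z | z.2 ≠ 0}) :
    ContinuousOn (gradFst h) {z | z.2 ≠ 0} := by
  have hD : ContDiffOn ℝ 1 (fderiv ℝ h) {z | z.2 ≠ 0} :=
    hh.fderiv_of_isOpen isOpen_snd_ne_zero (by norm_num)
  exact (InnerProductSpace.toDual ℝ (Euc n)).symm.continuous.comp_continuousOn
    (hD.clm_comp contDiffOn_const).continuousOn

theorem continuousOn_secondDeriv (hh : ContDiffOn ℝ 2 h {z | z.2 ≠ 0}) :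
    ContinuousOn (secondDeriv h) {z | z.2 ≠ 0} :=
  (hh.fderiv_of_isOpen isOpen_snd_ne_zero (m := 1) (by norm_num)).continuousOn_fderiv_of_isOpen
    isOpen_snd_ne_zero le_rfl

theorem secondDeriv_symm (hh : ContDiffOn ℝ 2 h {z | z.2 ≠ 0}) {z : Euc n × Euc n} (hz : z.2 ≠ 0)
    (u v : Euc n × Euc n) : secondDeriv h z u v = secondDeriv h z v u :=
  ((hh z hz).contDiffAt (isOpen_snd_ne_zero.mem_nhds hz)).isSymmSndFDerivAt (by simp) u v

theorem exists_lipschitzOnWith_gradSnd (hh : ContDiffOn ℝ 2 h {z | z.2 ≠ 0})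
    {K : Set (Euc n × Euc n)} (hK : IsCompact K) (hK0 : K ⊆ {z | z.2 ≠ 0}) :
    ∃ L, LipschitzOnWith L (gradSnd h) K := by
  refine LocallyLipschitzOn.exists_lipschitzOnWith_of_compact hK fun z hz => ?_
  obtain ⟨L, t, ht, hL⟩ := (((contDiffOn_gradSnd hh) z (hK0 hz)).contDiffAt
    (isOpen_snd_ne_zero.mem_nhds (hK0 hz))).exists_lipschitzOnWith
  exact ⟨L, t, mem_nhdsWithin_of_mem_nhds ht, hL⟩

theorem hasFDerivAt_of_snd_ne_zero (hh : ContDiffOn ℝ 2 h {z | z.2 ≠ 0}) {z : Euc n × Euc n}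
    (hz : z.2 ≠ 0) : HasFDerivAt h (fderiv ℝ h z) z :=
  (((hh z hz).contDiffAt (isOpen_snd_ne_zero.mem_nhds hz)).differentiableAt
    two_ne_zero).hasFDerivAt

theorem hasFDerivAt_partial_snd (hh : ContDiffOn ℝ 2 h {z | z.2 ≠ 0}) (x : Euc n) {p : Euc n}
    (hp : p ≠ 0) : HasFDerivAt (fun q => h (x, q))
      ((fderiv ℝ h (x, p)).comp (ContinuousLinearMap.inr ℝ (Euc n) (Euc n))) p :=
  (hasFDerivAt_of_snd_ne_zero hh (z := (x, p)) hp).comp p (hasFDerivAt_prodMk_right x p)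

theorem hasFDerivAt_partial_fst (hh : ContDiffOn ℝ 2 h {z | z.2 ≠ 0}) (x : Euc n) {p : Euc n}
    (hp : p ≠ 0) : HasFDerivAt (fun y => h (y, p))
      ((fderiv ℝ h (x, p)).comp (ContinuousLinearMap.inl ℝ (Euc n) (Euc n))) x :=
  (hasFDerivAt_of_snd_ne_zero hh (z := (x, p)) hp).comp x (hasFDerivAt_prodMk_left x p)

variable {F : Euc n → Set (Euc n)}

/-- Envelope argument: if `v` attains the supremum at `p`, then `H(x, ·) - ⟨v, ·⟩` is nonnegative
and vanishes at `p`, so its gradient there is zero. -/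
theorem MayerJets.StandingHypothesis.gradSnd_hamiltonian (hF : StandingHypothesis F)
    (hh : ContDiffOn ℝ 2 (hamiltonian F) {z | z.2 ≠ 0}) (x : Euc n) {p : Euc n} (hp : p ≠ 0) :
    gradSnd (hamiltonian F) (x, p) ∈ F x ∧
      inner ℝ (gradSnd (hamiltonian F) (x, p)) p = hamiltonian F (x, p) := by
  obtain ⟨v, hv, hvp⟩ := hF.exists_inner_eq_hamiltonian x p
  have hmin : IsLocalMin (fun q => hamiltonian F (x, q) - innerSL ℝ v q) p := by
    refine Eventually.of_forall fun q => ?_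
    have h1 := hF.inner_le_hamiltonian hv q
    simp only [innerSL_apply_apply, hvp, sub_self]
    linarith
  have h0 := hmin.hasFDerivAt_eq_zero ((hasFDerivAt_partial_snd hh x hp).sub (innerSL ℝ v).hasFDerivAt)
  have hgv : gradSnd (hamiltonian F) (x, p) = v := by
    refine ext_inner_right ℝ fun k => ?_
    have := congrArg (fun A : Euc n →L[ℝ] ℝ => A k) h0
    rw [inner_gradSnd]
    simpa [sub_eq_zero] using this
  rw [hgv]
  exact ⟨hv, hvp⟩

/-- `H(x, ·)` lies above the linear function `⟨v, ·⟩`, which is its tangent at `p`; the Taylor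
expansion then leaves no room for a negative second derivative. -/
theorem MayerJets.StandingHypothesis.secondDeriv_hamiltonian_nonneg (hF : StandingHypothesis F)
    (hh : ContDiffOn ℝ 2 (hamiltonian F) {z | z.2 ≠ 0}) (x : Euc n) {p : Euc n} (hp : p ≠ 0)
    (k : Euc n) : 0 ≤ secondDeriv (hamiltonian F) (x, p) (0, k) (0, k) := by
  obtain ⟨hv, hvp⟩ := hF.gradSnd_hamiltonian hh x hp
  set v := gradSnd (hamiltonian F) (x, p) with hvdef
  refine le_of_forall_pos_le_add fun ε hε => ?_
  set η := ε / (2 * (‖k‖ + 1) ^ 2) with hη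
  have hη0 : 0 < η := by positivity
  obtain ⟨r, hr, ht⟩ := IsCompact.exists_taylor_two (h := hamiltonian F) isOpen_snd_ne_zero
    (isCompact_singleton (x := (x, p))) (by simpa using hp) hh hη0
  set t := r / (‖k‖ + 1) with htdef
  have ht0 : 0 < t := by positivity
  have hnorm : ‖((0 : Euc n), t • k)‖ = t * ‖k‖ := by
    simp [Prod.norm_def, norm_smul, abs_of_pos ht0]
    positivity
  have h1 := ht (x, p) rfl (0, t • k) (by
    rw [hnorm, htdef, div_mul_eq_mul_div, div_le_iff₀ (by positivity)]; nlinarith [norm_nonneg k])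
  have h2 := hF.inner_le_hamiltonian hv (p + t • k)
  rw [inner_add_right, hvp, hvdef, inner_gradSnd] at h2
  have h3 : ((0 : Euc n), t • k) = t • ((0 : Euc n), k) := by simp
  rw [hnorm, Prod.mk_add_mk, add_zero] at h1
  have h4 := (abs_le.1 h1).2
  have h5 : fderiv ℝ (fderiv ℝ (hamiltonian F)) (x, p) (0, t • k) (0, t • k) =
      t ^ 2 * secondDeriv (hamiltonian F) (x, p) (0, k) (0, k) := by
    simp only [h3, map_smul, smul_apply, smul_eq_mul, secondDeriv]
    ring
  rw [h5] at h4
  have h6 : 0 ≤ t ^ 2 * (secondDeriv (hamiltonian F) (x, p) (0, k) (0, k) + 2 * η * ‖k‖ ^ 2) := by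
    nlinarith
  have h7 := nonneg_of_mul_nonneg_right h6 (by positivity)
  have h8 : 2 * η * ‖k‖ ^ 2 ≤ ε := by
    have h9 : 2 * η * (‖k‖ + 1) ^ 2 = ε := by rw [hη]; field_simp
    have h10 : ‖k‖ ^ 2 ≤ (‖k‖ + 1) ^ 2 := by gcongr; linarith
    nlinarith
  linarith

end Hamiltonian

/-! ### Trajectories and the value function -/

section Trajectories

variable {n : ℕ} {F : Euc n → Set (Euc n)} {φ : Euc n → ℝ}

theorem ae_mem_Ioo_of_mem_Icc (a b : ℝ) : ∀ᵐ s : ℝ, s ∈ Icc a b → s ∈ Ioo a b := by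
  filter_upwards [(Set.toFinite ({a, b} : Set ℝ)).countable.ae_notMem volume] with s hs hsI
  simp only [mem_insert_iff, mem_singleton_iff, not_or] at hs
  exact ⟨lt_of_le_of_ne hsI.1 (Ne.symm hs.1), lt_of_le_of_ne hsI.2 hs.2⟩

theorem MayerJets.StandingHypothesis.isTrajectory_of_hasDerivWithinAt (hF : StandingHypothesis F)
    {a b : ℝ} (hab : a ≤ b) {y v : ℝ → Euc n} (hv : ∀ s ∈ Icc a b, v s ∈ F (y s))
    (hy : ∀ s ∈ Icc a b, HasDerivWithinAt y (v s) (Icc a b) s) : IsTrajectory F a b y := by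
  obtain ⟨γ, hγ, hg⟩ := hF.growth
  obtain ⟨B, hB⟩ := isCompact_Icc.exists_bound_of_continuousOn
    (fun s hs => (hy s hs).continuousWithinAt : ContinuousOn y (Icc a b))
  refine ⟨AbsolutelyContinuousOnInterval.of_dist_le (L := γ * (1 + B)) hab fun s hs r hr => ?_, ?_⟩
  · have := (convex_Icc a b).norm_image_sub_le_of_norm_hasDerivWithin_le (C := γ * (1 + B)) hy
      (fun s hs => (hg _ _ (hv s hs)).trans (by gcongr; exact hB s hs)) hr hs
    simpa [dist_eq_norm] using this
  · filter_upwards [ae_mem_Ioo_of_mem_Icc a b] with s hs hsI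
    exact ⟨v s, hv s hsI, (hy s hsI).hasDerivAt (Icc_mem_nhds (hs hsI).1 (hs hsI).2)⟩

theorem MayerJets.IsTrajectory.mono {a b c d : ℝ} {y : ℝ → Euc n} (hy : IsTrajectory F a b y)
    (hac : a ≤ c) (hcd : c ≤ d) (hdb : d ≤ b) : IsTrajectory F c d y := by
  have hsub : Icc c d ⊆ Icc a b := Icc_subset_Icc hac hdb
  refine ⟨hy.1.mono ?_, ?_⟩
  · rw [uIcc_of_le hcd, uIcc_of_le (hac.trans (hcd.trans hdb))]; exact hsub
  · filter_upwards [hy.2] with s hs hsI using hs (hsub hsI)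

theorem MayerJets.StandingHypothesis.trajectory_bounds (hF : StandingHypothesis F) (r d : ℝ) :
    ∃ M L : ℝ, ∀ (a b : ℝ), a ≤ b → b - a ≤ d → ∀ y : ℝ → Euc n, IsTrajectory F a b y →
      ‖y a‖ ≤ r → (∀ s ∈ Icc a b, ‖y s‖ ≤ M) ∧
        ∀ s ∈ Icc a b, ∀ t ∈ Icc a b, dist (y s) (y t) ≤ L * |s - t| := by
  obtain ⟨γ, hγ, hg⟩ := hF.growth
  obtain ⟨M, hM⟩ := AbsolutelyContinuousOnInterval.bounds_of_growth (E := Euc n) hγ.le r d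
  refine ⟨M, γ * (1 + M), fun a b hab hd y hy hr => hM a b hab hd y hy.1 ?_ hr⟩
  filter_upwards [hy.2] with s hs hsI
  obtain ⟨v, hv, h⟩ := hs hsI
  exact ⟨v, hg _ _ hv, h⟩

/-- By linear growth trajectories are Lipschitz, so the glued curve is Lipschitz and hence
absolutely continuous; the junction time is a null set. -/
theorem MayerJets.StandingHypothesis.isTrajectory_concat (hF : StandingHypothesis F) {a t b : ℝ}
    (hat : a ≤ t) (htb : t ≤ b) {y z : ℝ → Euc n} (hy : IsTrajectory F a t y)
    (hz : IsTrajectory F t b z) (hyz : y t = z t) :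
    IsTrajectory F a b (fun s => if s ≤ t then y s else z s) := by
  obtain ⟨_, L₁, h₁⟩ := hF.trajectory_bounds ‖y a‖ (t - a)
  obtain ⟨_, L₂, h₂⟩ := hF.trajectory_bounds ‖z t‖ (b - t)
  have hly := (h₁ a t hat le_rfl y hy le_rfl).2
  have hlz := (h₂ t b htb le_rfl z hz le_rfl).2
  set w : ℝ → Euc n := fun s => if s ≤ t then y s else z s with hw
  have hwy : ∀ s, s ≤ t → w s = y s := fun s hs => if_pos hs
  have hwz : ∀ s, t ≤ s → w s = z s := fun s hs => by
    rcases hs.eq_or_lt with rfl | hs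
    · rw [hwy _ le_rfl, hyz]
    · exact if_neg hs.not_ge
  set L := max L₁ L₂ with hL
  have key : ∀ s ∈ Icc a b, ∀ r ∈ Icc a b, s ≤ r → dist (w s) (w r) ≤ L * |s - r| := by
    intro s hs r hr hsr
    rw [abs_sub_comm, abs_of_nonneg (sub_nonneg.2 hsr)]
    have d1 : ∀ u v, a ≤ u → u ≤ v → v ≤ t → dist (w u) (w v) ≤ L * (v - u) := fun u v hu huv hv => by
      rw [hwy u (huv.trans hv), hwy v hv]
      refine (hly u ⟨hu, huv.trans hv⟩ v ⟨hu.trans huv, hv⟩).trans ?_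
      rw [abs_sub_comm, abs_of_nonneg (sub_nonneg.2 huv)]
      exact mul_le_mul_of_nonneg_right (le_max_left _ _) (sub_nonneg.2 huv)
    have d2 : ∀ u v, t ≤ u → u ≤ v → v ≤ b → dist (w u) (w v) ≤ L * (v - u) := fun u v hu huv hv => by
      rw [hwz u hu, hwz v (hu.trans huv)]
      refine (hlz u ⟨hu, huv.trans hv⟩ v ⟨hu.trans huv, hv⟩).trans ?_
      rw [abs_sub_comm, abs_of_nonneg (sub_nonneg.2 huv)]
      exact mul_le_mul_of_nonneg_right (le_max_right _ _) (sub_nonneg.2 huv)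
    rcases le_total r t with hrt | hrt
    · exact d1 s r hs.1 hsr hrt
    rcases le_total t s with hts | hts
    · exact d2 s r hts hsr hr.2
    · calc dist (w s) (w r) ≤ dist (w s) (w t) + dist (w t) (w r) := dist_triangle _ _ _
        _ ≤ L * (t - s) + L * (r - t) := add_le_add (d1 s t hs.1 hts le_rfl) (d2 t r le_rfl hrt hr.2)
        _ = L * (r - s) := by ring
  refine ⟨AbsolutelyContinuousOnInterval.of_dist_le (hat.trans htb) (L := L) fun s hs r hr => ?_, ?_⟩
  · rcases le_total s r with h | h
    · exact key s hs r hr h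
    · rw [dist_comm, abs_sub_comm]; exact key r hr s hs h
  · filter_upwards [hy.2, hz.2, (Set.countable_singleton t).ae_notMem volume] with s hsy hsz hst hsI
    rcases lt_or_gt_of_ne (show s ≠ t from hst) with h | h
    · obtain ⟨v, hv, hd⟩ := hsy ⟨hsI.1, h.le⟩
      refine ⟨v, by rwa [hwy s h.le], hd.congr_of_eventuallyEq ?_⟩
      filter_upwards [Iio_mem_nhds h] with u hu using hwy u (le_of_lt hu)
    · obtain ⟨v, hv, hd⟩ := hsz ⟨h.le, hsI.2⟩
      refine ⟨v, by rwa [hwz s h.le], hd.congr_of_eventuallyEq ?_⟩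
      filter_upwards [Ioi_mem_nhds h] with u hu using hwz u (le_of_lt hu)

/-- For a fixed covector `e ≠ 0`, `∇ₚH(·, e)` is a locally Lipschitz selection of `F`, and linear
growth excludes blow-up. -/
theorem MayerJets.StandingHypothesis.exists_isTrajectory (hF : StandingHypothesis F)
    (hh : ContDiffOn ℝ 2 (hamiltonian F) {z | z.2 ≠ 0}) {e : Euc n} (he : e ≠ 0) {a b : ℝ}
    (hab : a ≤ b) (z : Euc n) : ∃ y, IsTrajectory F a b y ∧ y a = z := by
  obtain ⟨γ, hγ, hg⟩ := hF.growth
  obtain ⟨M, hM⟩ := AbsolutelyContinuousOnInterval.bounds_of_growth (E := Euc n) hγ.le ‖z‖ (b - a)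
  set ρ := 2 * (|M| + 1) with hρ
  have hρ0 : 0 < ρ := by positivity
  obtain ⟨χ, K, hχ, hχρ, hχle, hχe⟩ := exists_cutoff_id (E := Euc n) hρ0
  obtain ⟨L, hL⟩ := exists_lipschitzOnWith_gradSnd hh
    (K := Metric.closedBall (0 : Euc n) ρ ×ˢ {e})
    ((isCompact_closedBall 0 ρ).prod isCompact_singleton)
    (fun q hq => by rw [mem_ofPred_eq, show q.2 = e from hq.2]; exact he)
  have hgr : ∀ y, ‖gradSnd (hamiltonian F) (χ y, e)‖ ≤ γ * (1 + ‖χ y‖) := fun y =>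
    hg _ _ (hF.gradSnd_hamiltonian hh (χ y) he).1
  obtain ⟨y, hya, hy⟩ := exists_solution_of_bounded_lipschitz
    (f := fun _ y => gradSnd (hamiltonian F) (χ y, e)) (a := a) (b := b) (B := γ * (1 + ρ))
    (K := L * K) (fun s _ => LipschitzWith.of_dist_le_mul fun u v => by
      refine (hL.dist_le_mul (χ u, e) ⟨by simpa using hχρ u, rfl⟩ (χ v, e)
        ⟨by simpa using hχρ v, rfl⟩).trans ?_
      rw [NNReal.coe_mul, mul_assoc]
      refine mul_le_mul_of_nonneg_left ?_ L.2
      simpa [Prod.dist_eq] using hχ.dist_le_mul u v)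
    (fun y => continuousOn_const) (fun s _ y => (hgr y).trans (by gcongr; exact hχρ y))
    (left_mem_Icc.2 hab) z
  have hac : AbsolutelyContinuousOnInterval y a b := by
    refine AbsolutelyContinuousOnInterval.of_dist_le (L := γ * (1 + ρ)) hab fun s hs r hr => ?_
    have := (convex_Icc a b).norm_image_sub_le_of_norm_hasDerivWithin_le (C := γ * (1 + ρ)) hy
      (fun s hs => (hgr _).trans (by gcongr; exact hχρ _)) hr hs
    simpa [dist_eq_norm] using this
  -- The cut-off does not increase norms, so the truncated field obeys the same growth bound and the
  -- a priori bound `M` applies. Since `ρ / 2 > M`, the cut-off is never active.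
  have hb := (hM a b hab le_rfl y hac (by
    filter_upwards [ae_mem_Ioo_of_mem_Icc a b] with s hs hsI
    exact ⟨_, (hgr _).trans (by gcongr; exact hχle _),
      (hy s hsI).hasDerivAt (Icc_mem_nhds (hs hsI).1 (hs hsI).2)⟩) (by rw [hya])).1
  have hχy : ∀ s ∈ Icc a b, χ (y s) = y s := fun s hs => hχe _ (by
    have := (hb s hs).trans (le_abs_self M)
    rw [hρ]; linarith)
  refine ⟨y, hF.isTrajectory_of_hasDerivWithinAt hab
    (v := fun s => gradSnd (hamiltonian F) (χ (y s), e)) (fun s hs => ?_) hy, hya⟩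
  have := (hF.gradSnd_hamiltonian hh (χ (y s)) he).1
  rwa [hχy s hs] at this ⊢

theorem MayerJets.StandingHypothesis.bddBelow_cost (hF : StandingHypothesis F) (hφ : Continuous φ) {t T : ℝ}
    (ht : t ≤ T) (z : Euc n) :
    BddBelow {r : ℝ | ∃ x : ℝ → Euc n, IsTrajectory F t T x ∧ x t = z ∧ r = φ (x T)} := by
  obtain ⟨M, L, h⟩ := hF.trajectory_bounds ‖z‖ (T - t)
  obtain ⟨m, hm⟩ := ((isCompact_closedBall (0 : Euc n) M).image hφ).bddBelow
  refine ⟨m, ?_⟩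
  rintro _ ⟨x, hx, hxt, rfl⟩
  refine hm (mem_image_of_mem _ ?_)
  simpa using (h t T ht le_rfl x hx (by rw [hxt])).1 T (right_mem_Icc.2 ht)

theorem MayerJets.StandingHypothesis.valueFunction_le (hF : StandingHypothesis F) (hφ : Continuous φ)
    {t T : ℝ} (ht : t ≤ T) {y : ℝ → Euc n} (hy : IsTrajectory F t T y) :
    valueFunction F φ T t (y t) ≤ φ (y T) :=
  csInf_le (hF.bddBelow_cost hφ ht _) ⟨y, hy, rfl, rfl⟩

/-- The dynamic programming inequality. -/
theorem MayerJets.StandingHypothesis.valueFunction_mono (hF : StandingHypothesis F)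
    (hh : ContDiffOn ℝ 2 (hamiltonian F) {z | z.2 ≠ 0}) {e : Euc n} (he : e ≠ 0)
    (hφ : Continuous φ) {a t T : ℝ} (hat : a ≤ t) (ht : t ≤ T) {y : ℝ → Euc n}
    (hy : IsTrajectory F a t y) : valueFunction F φ T a (y a) ≤ valueFunction F φ T t (y t) := by
  -- Some trajectory must start at `(t, y t)`: a real `sInf` over the empty set would be `0`.
  obtain ⟨z, hz, hzt⟩ := hF.exists_isTrajectory hh he ht (y t)
  refine le_csInf ⟨_, z, hz, hzt, rfl⟩ ?_
  rintro _ ⟨x, hx, hxt, rfl⟩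
  refine csInf_le (hF.bddBelow_cost hφ (hat.trans ht) _)
    ⟨_, hF.isTrajectory_concat hat ht hy hx hxt.symm, if_pos hat, ?_⟩
  -- If `t = T`, the concatenation at `T` is still on its first branch.
  rcases ht.eq_or_lt with rfl | h
  · simp [hxt]
  · simp [h.not_ge]

theorem valueFunction_of_isOptimal {t₀ T : ℝ} {x₀ : Euc n} {x : ℝ → Euc n}
    (hx : IsOptimal F φ T t₀ x₀ x) : valueFunction F φ T t₀ x₀ = φ (x T) := by
  refine IsLeast.csInf_eq ⟨⟨x, hx.1, hx.2.1, rfl⟩, ?_⟩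
  rintro _ ⟨y, hy, hyt, rfl⟩
  exact hx.2.2 y hy hyt

/-- A dual pair is continuously differentiable and solves the Hamiltonian system. -/
theorem MayerJets.IsDualArc.hasDerivWithinAt
    (hh : ContDiffOn ℝ 2 (hamiltonian F) {z | z.2 ≠ 0}) {t₀ T : ℝ} (ht₀ : t₀ ≤ T)
    {x p : ℝ → Euc n} (hx : IsTrajectory F t₀ T x) (hp : IsDualArc F φ t₀ T x p)
    (hp0 : ∀ t ∈ Icc t₀ T, p t ≠ 0) :
    (∀ s ∈ Icc t₀ T,
      HasDerivWithinAt x (gradSnd (hamiltonian F) (x s, p s)) (Icc t₀ T) s) ∧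
    ∀ s ∈ Icc t₀ T,
      HasDerivWithinAt p (-gradFst (hamiltonian F) (x s, p s)) (Icc t₀ T) s := by
  have hxc : ContinuousOn x (Icc t₀ T) := by simpa [uIcc_of_le ht₀] using hx.1.continuousOn
  have hpc : ContinuousOn p (Icc t₀ T) := by simpa [uIcc_of_le ht₀] using hp.1.continuousOn
  have hxp : ContinuousOn (fun s => (x s, p s)) (Icc t₀ T) := hxc.prodMk hpc
  constructor
  · refine hx.1.hasDerivWithinAt_of_ae ht₀
      ((contDiffOn_gradSnd hh).continuousOn.comp hxp fun s hs => hp0 s hs) ?_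
    filter_upwards [hp.2.1] with s hs hsI
    obtain ⟨⟨v, hv, hd⟩, -⟩ := hs hsI
    have : v = gradSnd (hamiltonian F) (x s, p s) := ext_inner_right ℝ fun k => by
      rw [eq_of_mem_frechetSubdifferential (hasFDerivAt_partial_snd hh (x s) (hp0 s hsI)) hv,
        inner_gradSnd]; simp
    rwa [← this]
  · refine hp.1.hasDerivWithinAt_of_ae ht₀
      ((continuousOn_gradFst hh).comp hxp fun s hs => hp0 s hs).neg ?_
    filter_upwards [hp.2.1] with s hs hsI
    obtain ⟨-, w, hw, hd⟩ := hs hsI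
    have : -w = gradFst (hamiltonian F) (x s, p s) := ext_inner_right ℝ fun k => by
      rw [eq_of_mem_frechetSubdifferential (hasFDerivAt_partial_fst hh (x s) (hp0 s hsI)) hw,
        inner_gradFst]; simp
    rwa [← this, neg_neg]

end Trajectories

/-! ### Riccati equations -/

section Riccati

/-- The right hand side of the Riccati equation `R' = -(A R + R B + R C R + D)`. -/
def riccatiField {𝓐 : Type*} [Ring 𝓐] (A B C D R : 𝓐) : 𝓐 :=
  -(A * R + R * B + R * C * R + D)

theorem ContinuousOn.exists_norm_le_Icc {F : Type*} [SeminormedAddCommGroup F] {f : ℝ → F} {a b : ℝ}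
    (hf : ContinuousOn f (Icc a b)) : ∃ M > 0, ∀ s ∈ Icc a b, ‖f s‖ ≤ M := by
  obtain ⟨M, hM⟩ := isCompact_Icc.exists_bound_of_continuousOn hf
  exact ⟨max M 1, by positivity, fun s hs => (hM s hs).trans (le_max_left _ _)⟩

variable {𝓐 : Type*} [NormedRing 𝓐] [NormedAlgebra ℝ 𝓐]

/-- A solution of the Riccati equation with an a priori bound exists globally. -/
theorem exists_riccati_solution_of_bound [FiniteDimensional ℝ 𝓐] {A B C D : ℝ → 𝓐} {a b : ℝ}
    (hab : a ≤ b) (hA : ContinuousOn A (Icc a b)) (hB : ContinuousOn B (Icc a b))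
    (hC : ContinuousOn C (Icc a b)) (hD : ContinuousOn D (Icc a b)) (R₀ : 𝓐) {M : ℝ}
    (hM : ∀ c, a < c → c ≤ b → ∀ R : ℝ → 𝓐, R a = R₀ →
      (∀ s ∈ Icc a c, HasDerivWithinAt R (riccatiField (A s) (B s) (C s) (D s) (R s))
        (Icc a c) s) → ‖R c‖ ≤ M) :
    ∃ R : ℝ → 𝓐, R a = R₀ ∧ ∀ s ∈ Icc a b,
      HasDerivWithinAt R (riccatiField (A s) (B s) (C s) (D s) (R s)) (Icc a b) s := by
  have : CompleteSpace 𝓐 := FiniteDimensional.complete ℝ 𝓐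
  -- `N` strictly exceeds both the a priori bound and the initial norm; the cut-off of radius `2 N`
  -- is the identity up to norm `N`.
  set N := max M ‖R₀‖ + 1 with hN
  have hN0 : 0 < N := by positivity
  obtain ⟨χ, K, hχ, hχρ, -, hχe⟩ := exists_cutoff_id (E := 𝓐) (ρ := 2 * N) (by positivity)
  obtain ⟨α, hα0, hα⟩ := hA.exists_norm_le_Icc
  obtain ⟨β, hβ0, hβ⟩ := hB.exists_norm_le_Icc
  obtain ⟨κ, hκ0, hκ⟩ := hC.exists_norm_le_Icc
  obtain ⟨δ, hδ0, hδ⟩ := hD.exists_norm_le_Icc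
  set L : ℝ := α + β + 2 * N * κ + κ * (2 * N) with hL
  have hL0 : 0 ≤ L := by positivity
  obtain ⟨R, hRa, hR⟩ := exists_solution_of_bounded_lipschitz
    (f := fun s X => riccatiField (A s) (B s) (C s) (D s) (χ X)) (a := a) (b := b)
    (B := α * (2 * N) + 2 * N * β + 2 * N * κ * (2 * N) + δ) (K := L.toNNReal * K)
    (fun s hs => LipschitzWith.of_dist_le_mul fun X Y => by
      have h1 : riccatiField (A s) (B s) (C s) (D s) (χ X) -
          riccatiField (A s) (B s) (C s) (D s) (χ Y) =
          -(A s * (χ X - χ Y) + (χ X - χ Y) * B s + χ X * C s * (χ X - χ Y) +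
            (χ X - χ Y) * (C s * χ Y)) := by
        simp only [riccatiField]; noncomm_ring
      have h2 : ‖A s * (χ X - χ Y) + (χ X - χ Y) * B s + χ X * C s * (χ X - χ Y) +
            (χ X - χ Y) * (C s * χ Y)‖ ≤ L * ‖χ X - χ Y‖ := by
        calc _ ≤ ‖A s * (χ X - χ Y)‖ + ‖(χ X - χ Y) * B s‖ + ‖χ X * C s * (χ X - χ Y)‖ +
              ‖(χ X - χ Y) * (C s * χ Y)‖ := norm_add₄_le
          _ ≤ α * ‖χ X - χ Y‖ + ‖χ X - χ Y‖ * β + 2 * N * κ * ‖χ X - χ Y‖ +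
              ‖χ X - χ Y‖ * (κ * (2 * N)) := by
            gcongr
            · exact (norm_mul_le _ _).trans (by gcongr; exact hα s hs)
            · exact (norm_mul_le _ _).trans (by gcongr; exact hβ s hs)
            · refine (norm_mul_le _ _).trans ?_
              gcongr
              exact (norm_mul_le _ _).trans (by gcongr; exacts [hχρ X, hκ s hs])
            · refine (norm_mul_le _ _).trans ?_
              gcongr
              exact (norm_mul_le _ _).trans (by gcongr; exacts [hκ s hs, hχρ Y])
          _ = L * ‖χ X - χ Y‖ := by rw [hL]; ring
      rw [dist_eq_norm, h1, norm_neg, NNReal.coe_mul, Real.coe_toNNReal _ hL0, mul_assoc L]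
      refine h2.trans (mul_le_mul_of_nonneg_left ?_ hL0)
      rw [← dist_eq_norm]
      exact hχ.dist_le_mul X Y)
    (fun X => by simp only [riccatiField]; fun_prop)
    (fun s hs X => by
      rw [riccatiField, norm_neg]
      refine norm_add₄_le.trans ?_
      gcongr
      · exact (norm_mul_le _ _).trans (by gcongr; exacts [hα s hs, hχρ X])
      · exact (norm_mul_le _ _).trans (by gcongr; exacts [hχρ X, hβ s hs])
      · refine (norm_mul_le _ _).trans ?_
        gcongr
        · exact (norm_mul_le _ _).trans (by gcongr; exacts [hχρ X, hκ s hs])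
        · exact hχρ X
      · exact hδ s hs) (left_mem_Icc.2 hab) R₀
  have hRc : ContinuousOn (fun s => ‖R s‖) (Icc a b) :=
    ContinuousOn.norm fun s hs => (hR s hs).continuousWithinAt
  have hRaN : ‖R a‖ < N := by rw [hRa, hN]; linarith [le_max_right M ‖R₀‖]
  have hsol : ∀ c ≤ b, (∀ s ∈ Icc a c, ‖R s‖ ≤ N) → ∀ s ∈ Icc a c,
      HasDerivWithinAt R (riccatiField (A s) (B s) (C s) (D s) (R s)) (Icc a c) s := by
    intro c hc h s hs
    have hsub : Icc a c ⊆ Icc a b := Icc_subset_Icc_right hc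
    have h1 := (hR s (hsub hs)).mono hsub
    rwa [hχe (R s) (by linarith [h s hs])] at h1
  refine ⟨R, hRa, hsol b le_rfl ?_⟩
  -- Otherwise let `c` be the first time at which `‖R‖ = N`. Up to `c` the curve solves the true
  -- equation, so `‖R c‖ ≤ M < N`.
  by_contra! hcon
  obtain ⟨s₀, hs₀, hs₀N⟩ := hcon
  have hivt : ∀ u ∈ Icc a b, N < ‖R u‖ → ∃ v ∈ Icc a u, ‖R v‖ = N := fun u hu hNu => by
    obtain ⟨v, hv, hvN⟩ := intermediate_value_Icc hu.1
      (hRc.mono (Icc_subset_Icc_right hu.2)) ⟨hRaN.le, hNu.le⟩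
    exact ⟨v, hv, hvN⟩
  have hGc : IsCompact {s ∈ Icc a b | ‖R s‖ = N} := by
    refine isCompact_Icc.of_isClosed_subset ?_ (sep_subset _ _)
    exact hRc.preimage_isClosed_of_isClosed isClosed_Icc (isClosed_singleton (x := N))
  obtain ⟨v₀, hv₀, hv₀N⟩ := hivt s₀ hs₀ hs₀N
  obtain ⟨c, ⟨hc, hcN⟩, hcmin⟩ := hGc.exists_isLeast ⟨v₀, ⟨hv₀.1, hv₀.2.trans hs₀.2⟩, hv₀N⟩
  have hac : a < c := lt_of_le_of_ne hc.1 fun h => by rw [← h] at hcN; linarith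
  have hle : ∀ s ∈ Icc a c, ‖R s‖ ≤ N := by
    intro u hu
    by_contra! hNu
    obtain ⟨v, hv, hvN⟩ := hivt u ⟨hu.1, hu.2.trans hc.2⟩ hNu
    have h1 : c ≤ v := hcmin ⟨⟨hv.1, hv.2.trans (hu.2.trans hc.2)⟩, hvN⟩
    have h2 : u = v := le_antisymm (hu.2.trans h1) hv.2
    rw [h2, hvN] at hNu
    exact lt_irrefl _ hNu
  have := hM c hac hc.2 R hRa (hsol c hc.2 hle)
  rw [hcN, hN] at this
  linarith [le_max_left M ‖R₀‖]

/-- Solutions of a Riccati equation with symmetric data are symmetric. -/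
theorem star_eq_of_riccati [StarRing 𝓐] [NormedStarGroup 𝓐] [StarModule ℝ 𝓐]
    {A B C D R : ℝ → 𝓐} {a b : ℝ} (hA : ContinuousOn A (Icc a b)) (hB : ContinuousOn B (Icc a b))
    (hC : ContinuousOn C (Icc a b)) (hAB : ∀ s ∈ Icc a b, star (A s) = B s)
    (hCs : ∀ s ∈ Icc a b, star (C s) = C s) (hDs : ∀ s ∈ Icc a b, star (D s) = D s)
    (hRa : star (R a) = R a)
    (hR : ∀ s ∈ Icc a b,
      HasDerivWithinAt R (riccatiField (A s) (B s) (C s) (D s) (R s)) (Icc a b) s) :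
    ∀ s ∈ Icc a b, star (R s) = R s := by
  obtain ⟨α, hα0, hα⟩ := hA.exists_norm_le_Icc
  obtain ⟨β, hβ0, hβ⟩ := hB.exists_norm_le_Icc
  obtain ⟨κ, hκ0, hκ⟩ := hC.exists_norm_le_Icc
  obtain ⟨N, hN0, hN⟩ := ContinuousOn.exists_norm_le_Icc
    (fun s hs => (hR s hs).continuousWithinAt : ContinuousOn R (Icc a b))
  -- `Z = R* - R` satisfies a homogeneous linear equation with `Z a = 0`, so Gronwall forces `Z =
  -- 0`.
  have hZ : ∀ s ∈ Icc a b, HasDerivWithinAt (fun s => star (R s) - R s)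
      (-(A s * (star (R s) - R s) + (star (R s) - R s) * B s +
        star (R s) * C s * (star (R s) - R s) + (star (R s) - R s) * (C s * R s))) (Icc a b) s := by
    intro s hs
    refine ((hR s hs).star.sub (hR s hs)).congr_deriv ?_
    have hBA : star (B s) = A s := by rw [← hAB s hs, star_star]
    simp only [riccatiField, star_neg, star_add, star_mul, hAB s hs, hBA, hCs s hs, hDs s hs]
    noncomm_ring
  intro s hs
  refine sub_eq_zero.1 (eq_zero_of_abs_deriv_le_mul_abs_self_of_eq_zero_right
    (K := α + β + N * κ + κ * N) (fun s hs => (hZ s hs).continuousWithinAt)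
    (fun s hs => (hZ s (Ico_subset_Icc_self hs)).Ici_of_Icc hs) (by simp [hRa])
    (fun s hs => ?_) s hs)
  have hs' := Ico_subset_Icc_self hs
  set Z := star (R s) - R s
  rw [norm_neg]
  calc _ ≤ ‖A s * Z‖ + ‖Z * B s‖ + ‖star (R s) * C s * Z‖ + ‖Z * (C s * R s)‖ := norm_add₄_le
    _ ≤ α * ‖Z‖ + ‖Z‖ * β + N * κ * ‖Z‖ + ‖Z‖ * (κ * N) := by
      gcongr
      · exact (norm_mul_le _ _).trans (by gcongr; exact hα s hs')
      · exact (norm_mul_le _ _).trans (by gcongr; exact hβ s hs')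
      · refine (norm_mul_le _ _).trans ?_
        gcongr
        refine (norm_mul_le _ _).trans ?_
        rw [norm_star]
        gcongr
        exacts [hN s hs', hκ s hs']
      · refine (norm_mul_le _ _).trans ?_
        gcongr
        exact (norm_mul_le _ _).trans (by gcongr; exacts [hκ s hs', hN s hs'])
    _ = _ := by ring

end Riccati

/-! ### A priori bounds for Riccati equations with nonnegative quadratic term -/

section PosSemidefBound

variable {n : ℕ}

/-- The sum of the diagonal entries controls a nonnegative symmetric operator. -/
theorem norm_le_sum_inner_of_nonneg {S : Euc n →L[ℝ] Euc n}
    (hsym : ∀ u v, inner ℝ (S u) v = inner ℝ u (S v)) (hpos : ∀ v, 0 ≤ inner ℝ (S v) v) :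
    ‖S‖ ≤ n * n * ∑ i, inner ℝ (S (stdVec i)) (stdVec i) := by
  set τ := ∑ i, inner ℝ (S (stdVec i)) (stdVec i) with hτ
  have hdiag : ∀ i, inner ℝ (S (stdVec i)) (stdVec i) ≤ τ := fun i =>
    Finset.single_le_sum (f := fun i => inner ℝ (S (stdVec i)) (stdVec i))
      (fun j _ => hpos (stdVec j)) (Finset.mem_univ i)
  have hτ0 : 0 ≤ τ := Finset.sum_nonneg fun i _ => hpos (stdVec i)
  have hent : ∀ i j, |S (stdVec j) i| ≤ τ := by
    intro i j
    have h1 : S (stdVec j) i = inner ℝ (S (stdVec j)) (stdVec i) := by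
      simp [stdVec, EuclideanSpace.inner_single_right]
    -- Positivity on `eᵢ ± eⱼ` bounds twice an off-diagonal entry by the sum of two diagonal ones.
    have h2 := hpos (stdVec i + stdVec j)
    have h3 := hpos (stdVec i - stdVec j)
    have h4 : inner ℝ (S (stdVec i)) (stdVec j) = inner ℝ (S (stdVec j)) (stdVec i) := by
      rw [hsym, real_inner_comm]
    simp only [map_add, map_sub, inner_add_left, inner_add_right, inner_sub_left,
      inner_sub_right, h4] at h2 h3
    rw [h1, abs_le]
    constructor <;> linarith [hdiag i, hdiag j]
  have hcol : ∀ j, ‖S (stdVec j)‖ ≤ n * τ := by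
    intro j
    have h1 : S (stdVec j) = ∑ i, (S (stdVec j) i) • (stdVec i : Euc n) := by
      have := (EuclideanSpace.basisFun (Fin n) ℝ).sum_repr (S (stdVec j))
      simpa [stdVec] using this.symm
    rw [h1]
    refine (norm_sum_le _ _).trans ?_
    calc _ ≤ ∑ _i : Fin n, τ := Finset.sum_le_sum fun i _ => by
          rw [norm_smul]
          simpa [stdVec] using hent i j
      _ = n * τ := by simp
  refine ContinuousLinearMap.opNorm_le_bound _ (by positivity) fun v => ?_
  have h1 : v = ∑ j, v j • (stdVec j : Euc n) := by
    have := (EuclideanSpace.basisFun (Fin n) ℝ).sum_repr v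
    simpa [stdVec] using this.symm
  conv_lhs => rw [h1, map_sum]
  refine (norm_sum_le _ _).trans ?_
  calc _ ≤ ∑ _j : Fin n, ‖v‖ * (n * τ) := Finset.sum_le_sum fun j _ => by
        rw [map_smul, norm_smul]
        exact mul_le_mul (PiLp.norm_apply_le v j) (hcol j) (norm_nonneg _) (norm_nonneg _)
    _ = n * n * τ * ‖v‖ := by simp; ring

theorem abs_inner_clm_self_le (S : Euc n →L[ℝ] Euc n) (i : Fin n) :
    |inner ℝ (S (stdVec i)) (stdVec i)| ≤ ‖S‖ := by
  refine (abs_real_inner_le_norm _ _).trans ?_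
  have h := S.le_opNorm (stdVec i)
  have h1 : ‖(stdVec i : Euc n)‖ = 1 := by simp [stdVec]
  rw [h1, mul_one] at h ⊢
  exact h

/-- A lower bound on a symmetric solution of the Riccati equation with `C ≥ 0` implies a bound on
its norm. -/
theorem exists_norm_bound_of_riccati {A B C D : ℝ → Euc n →L[ℝ] Euc n} {a b : ℝ}
    (hA : ContinuousOn A (Icc a b)) (hB : ContinuousOn B (Icc a b)) (hD : ContinuousOn D (Icc a b))
    (hC : ∀ s ∈ Icc a b, ∀ v, 0 ≤ inner ℝ (C s v) v) (R₀ : Euc n →L[ℝ] Euc n) (k : ℝ) :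
    ∃ M : ℝ, ∀ c ≤ b, ∀ R : ℝ → Euc n →L[ℝ] Euc n, R a = R₀ →
      (∀ s ∈ Icc a c,
        HasDerivWithinAt R (riccatiField (A s) (B s) (C s) (D s) (R s)) (Icc a c) s) →
      (∀ s ∈ Icc a c, ∀ u v, inner ℝ (R s u) v = inner ℝ u (R s v)) →
      (∀ s ∈ Icc a c, ∀ v, -k * ‖v‖ ^ 2 ≤ inner ℝ (R s v) v) → ∀ s ∈ Icc a c, ‖R s‖ ≤ M := by
  obtain ⟨α, hα0, hα⟩ := hA.exists_norm_le_Icc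
  obtain ⟨β, hβ0, hβ⟩ := hB.exists_norm_le_Icc
  obtain ⟨δ, hδ0, hδ⟩ := hD.exists_norm_le_Icc
  set K : ℝ := n * ((α + β) * (n * n)) with hK
  set ε : ℝ := n * ((α + β) * |k| + δ) with hε
  set τ₀ : ℝ := ∑ i, (inner ℝ (R₀ (stdVec i)) (stdVec i : Euc n) + k) with hτ₀
  refine ⟨n * n * gronwallBound |τ₀| K ε (b - a) + |k|, fun c hcb R hRa hR hsym hlow => ?_⟩
  -- `τ` is the trace of `R + k`, a nonnegative operator, so it controls `‖R‖`. It satisfies `τ' ≤ K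
  -- τ + ε`, because the only superlinear term of the equation enters with a favourable sign.
  set τ : ℝ → ℝ := fun s => ∑ i, (inner ℝ (R s (stdVec i)) (stdVec i : Euc n) + k) with hτ
  have hnorm : ∀ s ∈ Icc a c, ‖R s‖ ≤ n * n * τ s + |k| := by
    intro s hs
    have h1 := norm_le_sum_inner_of_nonneg (S := R s + k • ContinuousLinearMap.id ℝ (Euc n))
      (fun u v => by
        simp [inner_add_left, inner_add_right, inner_smul_left, inner_smul_right, hsym s hs])
      (fun v => by
        have := hlow s hs v
        simp [inner_add_left, inner_smul_left]
        linarith)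
    have h2 : ∑ i, inner ℝ ((R s + k • ContinuousLinearMap.id ℝ (Euc n)) (stdVec i))
        (stdVec i : Euc n) = τ s := by
      refine Finset.sum_congr rfl fun i _ => ?_
      have h3 : ‖(stdVec i : Euc n)‖ = 1 := by simp [stdVec]
      simp [inner_add_left, inner_smul_left, h3]
    rw [h2] at h1
    have h3 : ‖k • ContinuousLinearMap.id ℝ (Euc n)‖ ≤ |k| := by
      rw [norm_smul, Real.norm_eq_abs]
      exact mul_le_of_le_one_right (abs_nonneg _) ContinuousLinearMap.norm_id_le
    have h4 := norm_sub_le (R s + k • ContinuousLinearMap.id ℝ (Euc n))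
      (k • ContinuousLinearMap.id ℝ (Euc n))
    rw [add_sub_cancel_right] at h4
    linarith
  have hτd : ∀ s ∈ Icc a c, HasDerivWithinAt τ
      (∑ i, inner ℝ (riccatiField (A s) (B s) (C s) (D s) (R s) (stdVec i)) (stdVec i : Euc n))
      (Icc a c) s := by
    intro s hs
    refine HasDerivWithinAt.fun_sum fun i _ => HasDerivWithinAt.add_const _ ?_
    have h1 := ((hR s hs).clm_apply (hasDerivWithinAt_const s (Icc a c) (stdVec i : Euc n))).inner ℝ
      (hasDerivWithinAt_const s (Icc a c) (stdVec i : Euc n))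
    simpa using h1
  have hτ' : ∀ s ∈ Icc a c, ∑ i, inner ℝ
      (riccatiField (A s) (B s) (C s) (D s) (R s) (stdVec i)) (stdVec i : Euc n) ≤ K * τ s + ε := by
    intro s hs
    have hs' : s ∈ Icc a b := ⟨hs.1, hs.2.trans hcb⟩
    have hterm : ∀ i : Fin n, inner ℝ (riccatiField (A s) (B s) (C s) (D s) (R s) (stdVec i))
        (stdVec i : Euc n) ≤ (α + β) * (n * n * τ s + |k|) + δ := by
      intro i
      have e1 := neg_le_of_abs_le (abs_inner_clm_self_le (A s * R s) i)
      have e2 := neg_le_of_abs_le (abs_inner_clm_self_le (R s * B s) i)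
      have e3 := neg_le_of_abs_le (abs_inner_clm_self_le (D s) i)
      -- By symmetry of `R` this is `⟨C (R eᵢ), R eᵢ⟩`; no upper bound on `C` is needed.
      have e4 : 0 ≤ inner ℝ ((R s * C s * R s) (stdVec i)) (stdVec i : Euc n) := by
        have := hC s hs' (R s (stdVec i))
        simpa [hsym s hs] using this
      have e5 : ‖A s * R s‖ ≤ α * (n * n * τ s + |k|) :=
        (norm_mul_le _ _).trans (mul_le_mul (hα s hs') (hnorm s hs) (norm_nonneg _) hα0.le)
      have e6 : ‖R s * B s‖ ≤ (n * n * τ s + |k|) * β :=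
        (norm_mul_le _ _).trans (mul_le_mul (hnorm s hs) (hβ s hs') (norm_nonneg _)
          ((norm_nonneg _).trans (hnorm s hs)))
      have e7 := hδ s hs'
      simp only [riccatiField, neg_apply, add_apply, inner_neg_left, inner_add_left]
      linarith
    calc _ ≤ ∑ _i : Fin n, ((α + β) * (n * n * τ s + |k|) + δ) :=
          Finset.sum_le_sum fun i _ => hterm i
      _ = K * τ s + ε := by rw [hK, hε]; simp; ring
  have hg := le_gronwallBound_of_liminf_deriv_right_le (f := τ) (δ := |τ₀|) (K := K) (ε := ε)
    (a := a) (b := c) (fun s hs => (hτd s hs).continuousWithinAt)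
    (fun s hs r hr =>
      ((hτd s (Ico_subset_Icc_self hs)).Ici_of_Icc hs).liminf_right_slope_le hr)
    (by rw [hτ]; simp only [hRa]; exact le_abs_self _)
    (fun s hs => hτ' s (Ico_subset_Icc_self hs))
  intro s hs
  refine (hnorm s hs).trans ?_
  gcongr
  exact (hg s hs).trans (gronwallBound_mono (abs_nonneg _) (by positivity) (by positivity)
    (by linarith [hs.2]))

end PosSemidefBound

/-! ### Matrices and operators -/

section Operators

variable {n : ℕ}

/-- The operator on `ℝⁿ` associated with a matrix. -/
noncomputable abbrev matOp (Q : Matrix (Fin n) (Fin n) ℝ) : Euc n →L[ℝ] Euc n :=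
  Matrix.toEuclideanCLM (𝕜 := ℝ) Q

theorem matOp_apply (Q : Matrix (Fin n) (Fin n) ℝ) (u : Euc n) (i : Fin n) :
    matOp Q u i = ∑ j, Q i j * u j := by
  rw [matOp, Matrix.ofLp_toEuclideanCLM]; rfl

/-- One computation for all four Hessian blocks, `ι₁` and `ι₂` being the coordinate inclusions. The
row index is paired with `v`, which explains the order on the right. -/
theorem inner_matOp_of {P : Type*} [NormedAddCommGroup P] [NormedSpace ℝ P] (b : P →L[ℝ] P →L[ℝ] ℝ)
    (ι₁ ι₂ : Euc n →L[ℝ] P) (u v : Euc n) :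
    inner ℝ (matOp (Matrix.of fun i j => b (ι₁ (stdVec i)) (ι₂ (stdVec j))) u) v =
      b (ι₁ v) (ι₂ u) := by
  have h1 : ∀ w : Euc n, w = ∑ j, w j • (stdVec j : Euc n) := fun w => by
    have := (EuclideanSpace.basisFun (Fin n) ℝ).sum_repr w
    simpa [stdVec] using this.symm
  conv_rhs => rw [h1 u, h1 v]
  simp only [map_sum, map_smul, sum_apply, smul_apply, PiLp.inner_apply, matOp_apply, smul_eq_mul,
    Matrix.of_apply, RCLike.inner_apply, conj_trivial, Finset.mul_sum]
  rw [Finset.sum_comm]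
  refine Finset.sum_congr rfl fun i _ => Finset.sum_congr rfl fun j _ => ?_
  ring

theorem star_matOp (Q : Matrix (Fin n) (Fin n) ℝ) : star (matOp Q) = matOp Q.transpose := by
  rw [matOp, matOp, ← map_star, Matrix.star_eq_conjTranspose,
    Matrix.conjTranspose_eq_transpose_of_trivial]

theorem isSymm_iff_star_matOp {Q : Matrix (Fin n) (Fin n) ℝ} :
    Q.IsSymm ↔ star (matOp Q) = matOp Q := by
  rw [star_matOp, Matrix.IsSymm]
  exact ⟨fun h => by rw [h], fun h => (Matrix.toEuclideanCLM (𝕜 := ℝ) (n := Fin n)).injective h⟩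

theorem hasDerivWithinAt_matOp {R : ℝ → Matrix (Fin n) (Fin n) ℝ} {R' : Matrix (Fin n) (Fin n) ℝ}
    {s : Set ℝ} {t : ℝ} (h : ∀ i j, HasDerivWithinAt (fun u => R u i j) (R' i j) s t) :
    HasDerivWithinAt (fun u => matOp (R u)) (matOp R') s t := by
  have h1 : ∀ Q : Matrix (Fin n) (Fin n) ℝ,
      matOp Q = ∑ i, ∑ j, Q i j • matOp (Matrix.single i j (1 : ℝ)) := fun Q => by
    conv_lhs => rw [Matrix.matrix_eq_sum_single Q]
    simp only [matOp, map_sum]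
    refine Finset.sum_congr rfl fun i _ => Finset.sum_congr rfl fun j _ => ?_
    rw [← map_smul, Matrix.smul_single, smul_eq_mul, mul_one]
  rw [h1 R', show (fun u => matOp (R u)) = fun u => ∑ i, ∑ j, R u i j •
    matOp (Matrix.single i j (1 : ℝ)) from funext fun u => h1 (R u)]
  exact HasDerivWithinAt.fun_sum fun i _ => HasDerivWithinAt.fun_sum fun j _ =>
    (h i j).smul_const (matOp (Matrix.single i j (1 : ℝ)))

theorem continuousOn_matOp {X : Type*} [TopologicalSpace X] {R : X → Matrix (Fin n) (Fin n) ℝ}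
    {s : Set X} (h : ∀ i j, ContinuousOn (fun u => R u i j) s) :
    ContinuousOn (fun u => matOp (R u)) s := by
  have h1 : ContinuousOn R s := continuousOn_pi.2 fun i => continuousOn_pi.2 fun j => h i j
  exact (LinearMap.continuous_of_finiteDimensional
    (Matrix.toEuclideanCLM (𝕜 := ℝ) (n := Fin n)).toAlgEquiv.toLinearMap).comp_continuousOn h1

variable (h : Euc n × Euc n → ℝ) (z : Euc n × Euc n)

theorem inner_hessXX (u v : Euc n) :
    inner ℝ (matOp (hessXX h z) u) v = secondDeriv h z (v, 0) (u, 0) :=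
  inner_matOp_of (secondDeriv h z) (ContinuousLinearMap.inl ℝ _ _)
    (ContinuousLinearMap.inl ℝ _ _) u v

theorem inner_hessPX (u v : Euc n) :
    inner ℝ (matOp (hessPX h z) u) v = secondDeriv h z (v, 0) (0, u) :=
  inner_matOp_of (secondDeriv h z) (ContinuousLinearMap.inl ℝ _ _)
    (ContinuousLinearMap.inr ℝ _ _) u v

theorem inner_hessXP (u v : Euc n) :
    inner ℝ (matOp (hessXP h z) u) v = secondDeriv h z (0, v) (u, 0) :=
  inner_matOp_of (secondDeriv h z) (ContinuousLinearMap.inr ℝ _ _)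
    (ContinuousLinearMap.inl ℝ _ _) u v

theorem inner_hessPP (u v : Euc n) :
    inner ℝ (matOp (hessPP h z) u) v = secondDeriv h z (0, v) (0, u) :=
  inner_matOp_of (secondDeriv h z) (ContinuousLinearMap.inr ℝ _ _)
    (ContinuousLinearMap.inr ℝ _ _) u v

/-- The right hand side of the Riccati equation of the Hamiltonian `h` at `z`. -/
noncomputable def hamiltonRiccati (R : Euc n →L[ℝ] Euc n) : Euc n →L[ℝ] Euc n :=
  riccatiField (matOp (hessPX h z)) (matOp (hessXP h z)) (matOp (hessPP h z)) (matOp (hessXX h z)) R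

/-- The Riccati equation read as a quadratic form: the second derivative of `h` on the graph of `R`
expands into the four blocks and cancels `⟨R' d, d⟩`. -/
theorem inner_hamiltonRiccati {R : Euc n →L[ℝ] Euc n}
    (hR : ∀ u v, inner ℝ (R u) v = inner ℝ u (R v)) (d : Euc n) :
    inner ℝ (hamiltonRiccati h z R d) d + secondDeriv h z (d, R d) (d, R d) = 0 := by
  have h1 : (d, R d) = (d, 0) + (0, R d) := by simp
  rw [h1]
  simp only [map_add, add_apply, hamiltonRiccati, riccatiField, neg_apply,
    mul_apply_eq_comp, inner_neg_left, inner_add_left, hR, inner_hessXX, inner_hessPX,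
    inner_hessXP, inner_hessPP]
  ring

theorem isRiccatiSolution_iff {x p : ℝ → Euc n} {t₀ a : ℝ} {R₀ : Matrix (Fin n) (Fin n) ℝ}
    {R : ℝ → Matrix (Fin n) (Fin n) ℝ} :
    IsRiccatiSolution h x p t₀ a R₀ R ↔ R t₀ = R₀ ∧ ∀ t ∈ Icc t₀ a,
      HasDerivWithinAt (fun s => matOp (R s)) (hamiltonRiccati h (x t, p t) (matOp (R t)))
        (Icc t₀ a) t := by
  refine and_congr_right fun _ => forall₂_congr fun t _ => ⟨?_, fun hd => ?_⟩
  · rintro ⟨R', hR', he⟩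
    refine (hasDerivWithinAt_matOp hR').congr_deriv ?_
    rw [hamiltonRiccati, riccatiField, eq_neg_iff_add_eq_zero]
    simp only [matOp, ← map_mul, ← map_add]
    rw [← map_zero (Matrix.toEuclideanCLM (𝕜 := ℝ) (n := Fin n)), ← he]
    congr 1
    abel
  · refine ⟨-(hessPX h (x t, p t) * R t + R t * hessXP h (x t, p t)
      + R t * hessPP h (x t, p t) * R t + hessXX h (x t, p t)), fun i j => ?_, by abel⟩
    have he : ∀ Q : Matrix (Fin n) (Fin n) ℝ, Q i j = inner ℝ (matOp Q (stdVec j)) (stdVec i) :=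
      fun Q => by
        rw [stdVec, stdVec, EuclideanSpace.inner_single_right, matOp_apply]
        simp
    simp only [he]
    have h1 := ((hd.clm_apply (hasDerivWithinAt_const t (Icc t₀ a) (stdVec j : Euc n))).inner ℝ
      (hasDerivWithinAt_const t (Icc t₀ a) (stdVec i : Euc n)))
    refine h1.congr_deriv ?_
    simp only [hamiltonRiccati, riccatiField, matOp, ← map_mul, ← map_add, ← map_neg, map_zero,
      add_zero, inner_zero_right, zero_add]

end Operators

/-! ### Feedback trajectories near an extremal -/

section Feedback

variable {n : ℕ} {F : Euc n → Set (Euc n)} {φ : Euc n → ℝ}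

/-- Given an extremal `(x, p)` and a symmetric operator curve `S`, the feedback
`y' = ∇ₚH(y, p + S (y - x))` defines trajectories near `x` along which
`⟨p, y - x⟩ + ½ ⟨S (y - x), y - x⟩` varies, up to second order, as prescribed by `S'` and the second
derivative of the Hamiltonian. -/
theorem MayerJets.StandingHypothesis.exists_feedback (hF : StandingHypothesis F)
    (hh : ContDiffOn ℝ 2 (hamiltonian F) {z | z.2 ≠ 0}) {a b : ℝ} (hab : a ≤ b)
    {x p : ℝ → Euc n} (hp0 : ∀ s ∈ Icc a b, p s ≠ 0)
    (hx : ∀ s ∈ Icc a b, HasDerivWithinAt x (gradSnd (hamiltonian F) (x s, p s)) (Icc a b) s)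
    (hp : ∀ s ∈ Icc a b, HasDerivWithinAt p (-gradFst (hamiltonian F) (x s, p s)) (Icc a b) s)
    {S S' : ℝ → Euc n →L[ℝ] Euc n} (hS : ∀ s ∈ Icc a b, HasDerivWithinAt S (S' s) (Icc a b) s)
    (hsym : ∀ s ∈ Icc a b, ∀ u v, inner ℝ (S s u) v = inner ℝ u (S s v)) :
    ∃ C > 0, ∀ ε > 0, ∃ r > 0, ∀ s₁ ∈ Icc a b, ∀ d : Euc n, ‖d‖ ≤ r → ∃ δ : ℝ → Euc n, δ s₁ = d ∧
      IsTrajectory F a b (fun s => x s + δ s) ∧ (∀ s ∈ Icc a b, ‖δ s‖ ≤ C * ‖d‖) ∧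
      ∃ ψ' : ℝ → ℝ, (∀ s ∈ Icc a b, HasDerivWithinAt
        (fun s => inner ℝ (p s) (δ s) + 1 / 2 * inner ℝ (S s (δ s)) (δ s)) (ψ' s) (Icc a b) s) ∧
        ∀ s ∈ Icc a b, |ψ' s - 1 / 2 * (inner ℝ (S' s (δ s)) (δ s) +
          secondDeriv (hamiltonian F) (x s, p s) (δ s, S s (δ s)) (δ s, S s (δ s)))|
            ≤ ε * ‖d‖ ^ 2 := by
  set h := hamiltonian F with hhdef
  have hxc : ContinuousOn x (Icc a b) := fun s hs => (hx s hs).continuousWithinAt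
  have hpc : ContinuousOn p (Icc a b) := fun s hs => (hp s hs).continuousWithinAt
  have hSc : ContinuousOn S (Icc a b) := fun s hs => (hS s hs).continuousWithinAt
  obtain ⟨M, hM0, hM⟩ := hSc.exists_norm_le_Icc
  set K₀ : Set (Euc n × Euc n) := (fun s => (x s, p s)) '' Icc a b with hK₀
  have hK₀c : IsCompact K₀ := isCompact_Icc.image_of_continuousOn (hxc.prodMk hpc)
  have hK₀U : K₀ ⊆ {z | z.2 ≠ 0} := by rintro _ ⟨s, hs, rfl⟩; exact hp0 s hs
  -- A compact neighbourhood of the extremal that avoids `p = 0`; `ρ` below keeps `(x + d, p + S d)`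
  -- inside it.
  obtain ⟨r₀, hr₀, hthick⟩ := hK₀c.exists_cthickening_subset_open isOpen_snd_ne_zero hK₀U
  set K₁ := Metric.cthickening r₀ K₀ with hK₁
  have hK₁c : IsCompact K₁ := hK₀c.cthickening
  obtain ⟨L, hL⟩ := exists_lipschitzOnWith_gradSnd hh hK₁c hthick
  set ρ := r₀ / (1 + M) with hρ
  have hρ0 : 0 < ρ := by positivity
  have hw : ∀ s ∈ Icc a b, ∀ d : Euc n, ‖(d, S s d)‖ ≤ (1 + M) * ‖d‖ := fun s hs d => by
    refine max_le ?_ ?_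
    · nlinarith [norm_nonneg d]
    · refine ((S s).le_opNorm d).trans ?_
      nlinarith [norm_nonneg d, hM s hs]
  have hmem : ∀ s ∈ Icc a b, ∀ d ∈ Metric.closedBall (0 : Euc n) ρ,
      (x s + d, p s + S s d) ∈ K₁ := fun s hs d hd => by
    refine Metric.mem_cthickening_of_dist_le _ (x s, p s) _ _ ⟨s, hs, rfl⟩ ?_
    rw [dist_eq_norm, Prod.mk_sub_mk, add_sub_cancel_left, add_sub_cancel_left]
    refine (hw s hs d).trans ?_
    have : ‖d‖ ≤ r₀ / (1 + M) := by simpa using hd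
    rwa [le_div_iff₀ (by positivity), mul_comm] at this
  have hgc : ContinuousOn (gradSnd h) {z | z.2 ≠ 0} := (contDiffOn_gradSnd hh).continuousOn
  -- The equation for `δ = y - x` has equilibrium `0`, because `x` itself follows the feedback. `C`
  -- is fixed here, before `ε`.
  obtain ⟨C, hC0, r₁, hr₁, hsol⟩ := exists_solution_near_zero (a := a) (b := b) (ρ := ρ) hρ0
    (f := fun s d => gradSnd h (x s + d, p s + S s d) - gradSnd h (x s, p s))
    (K := L * (1 + M).toNNReal)
    (fun s hs => LipschitzOnWith.of_dist_le_mul fun u hu v hv => by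
      rw [dist_sub_right]
      refine (hL.dist_le_mul _ (hmem s hs u hu) _ (hmem s hs v hv)).trans ?_
      rw [NNReal.coe_mul, mul_assoc, Real.coe_toNNReal _ (by positivity)]
      refine mul_le_mul_of_nonneg_left ?_ L.2
      rw [dist_eq_norm, dist_eq_norm, Prod.mk_sub_mk, add_sub_add_left_eq_sub,
        add_sub_add_left_eq_sub, ← map_sub]
      exact hw s hs (u - v))
    (fun d hd => by
      refine ContinuousOn.sub (hgc.comp ?_ fun s hs => hthick (hmem s hs d hd))
        (hgc.comp (hxc.prodMk hpc) fun s hs => hp0 s hs)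
      exact (hxc.add continuousOn_const).prodMk (hpc.add (hSc.clm_apply continuousOn_const)))
    (fun s hs => by simp)
  refine ⟨C, hC0, fun ε hε => ?_⟩
  set B := (1 + M) * C with hB
  have hB0 : 0 < B := by positivity
  -- The Taylor increment `(δ, S δ)` has norm at most `B ‖d‖`, hence the accuracy `ε / B ^ 2`.
  obtain ⟨r₂, hr₂, htaylor⟩ := IsCompact.exists_taylor_two isOpen_snd_ne_zero hK₀c hK₀U hh
    (ε := ε / B ^ 2) (by positivity)
  refine ⟨min r₁ (r₂ / B), by positivity, fun s₁ hs₁ d hd => ?_⟩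
  obtain ⟨δ, hδ1, hδ, hδC, hδρ⟩ := hsol s₁ hs₁ d (hd.trans (min_le_left _ _))
  have hmemδ : ∀ s ∈ Icc a b, (x s + δ s, p s + S s (δ s)) ∈ K₁ := fun s hs =>
    hmem s hs _ (by simpa using hδρ s hs)
  have hwd : ∀ s ∈ Icc a b, ‖(δ s, S s (δ s))‖ ≤ B * ‖d‖ := fun s hs =>
    (hw s hs _).trans (by rw [hB, mul_assoc]; gcongr; exact hδC s hs)
  refine ⟨δ, hδ1, hF.isTrajectory_of_hasDerivWithinAt hab
    (v := fun s => gradSnd h (x s + δ s, p s + S s (δ s))) (fun s hs =>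
      (hF.gradSnd_hamiltonian hh _ (hthick (hmemδ s hs))).1) (fun s hs => ?_), hδC, ?_⟩
  · exact ((hx s hs).add (hδ s hs)).congr_deriv (by abel)
  refine ⟨_, fun s hs => ((hp s hs).inner ℝ (hδ s hs)).add
    ((((hS s hs).clm_apply (hδ s hs)).inner ℝ (hδ s hs)).const_mul (1 / 2 : ℝ)), fun s hs => ?_⟩
  have hq : p s + S s (δ s) ≠ 0 := hthick (hmemδ s hs)
  -- With `⟨∇ₚH, q⟩ = H` at the perturbed and the reference point, and symmetry of `S`, the quantity
  -- to estimate becomes exactly the second-order Taylor remainder of `H` at `(x, p)`.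
  have e1 := (hF.gradSnd_hamiltonian hh (x s + δ s) hq).2
  have e2 := (hF.gradSnd_hamiltonian hh (x s) (hp0 s hs)).2
  have e3 := inner_gradSnd h (x s, p s) (S s (δ s))
  have e4 := inner_gradFst h (x s, p s) (δ s)
  rw [← hhdef] at e1 e2
  have ht := htaylor (x s, p s) ⟨s, hs, rfl⟩ (δ s, S s (δ s)) (by
    refine (hwd s hs).trans ?_
    have := hd.trans (min_le_right _ _)
    rwa [le_div_iff₀ hB0, mul_comm] at this)
  have hD : fderiv ℝ h (x s, p s) (δ s, S s (δ s)) =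
      fderiv ℝ h (x s, p s) (δ s, 0) + fderiv ℝ h (x s, p s) (0, S s (δ s)) := by
    rw [← map_add]; simp
  rw [Prod.mk_add_mk, hD] at ht
  refine le_trans (le_of_eq ?_) (ht.trans ?_)
  · congr 1
    rw [← e1, ← e2, ← e3, ← e4]
    set g := gradSnd h (x s + δ s, p s + S s (δ s))
    set g₀ := gradSnd h (x s, p s)
    simp only [inner_neg_left, inner_add_left, inner_sub_right, inner_add_right, map_sub,
      inner_sub_left, secondDeriv]
    have s1 := hsym s hs g (δ s)
    have s2 := hsym s hs g₀ (δ s)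
    have s3 := real_inner_comm (S s (δ s)) g
    have s4 := real_inner_comm (S s (δ s)) g₀
    have s5 := real_inner_comm (p s) g
    have s6 := real_inner_comm (p s) g₀
    rw [s1, s2]
    linarith
  · calc _ ≤ ε / B ^ 2 * (B * ‖d‖) ^ 2 := by gcongr; exact hwd s hs
      _ = ε * ‖d‖ ^ 2 := by field_simp

end Feedback

/-! ### Propagation of subjets -/

section Propagation

variable {n : ℕ}

theorem star_eq_of_inner_eq {X Y : Euc n →L[ℝ] Euc n}
    (h : ∀ u v, inner ℝ (X u) v = inner ℝ (Y v) u) : star X = Y := by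
  refine ContinuousLinearMap.ext fun u => ext_inner_right ℝ fun v => ?_
  rw [ContinuousLinearMap.star_eq_adjoint, ContinuousLinearMap.adjoint_inner_left,
    real_inner_comm, h]

theorem inner_eq_of_star_eq {X : Euc n →L[ℝ] Euc n} (h : star X = X) (u v : Euc n) :
    inner ℝ (X u) v = inner ℝ u (X v) := by
  conv_lhs => rw [← h, ContinuousLinearMap.star_eq_adjoint,
    ContinuousLinearMap.adjoint_inner_left]

theorem continuousOn_secondDeriv_apply {h : Euc n × Euc n → ℝ}
    (hh : ContDiffOn ℝ 2 h {z | z.2 ≠ 0}) {z : ℝ → Euc n × Euc n} {a b : ℝ}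
    (hz : ContinuousOn z (Icc a b)) (hz0 : ∀ s ∈ Icc a b, (z s).2 ≠ 0)
    (u v : Euc n × Euc n) :
    ContinuousOn (fun s => secondDeriv h (z s) u v) (Icc a b) :=
  (((continuousOn_secondDeriv hh).comp hz fun s hs => hz0 s hs).clm_apply
    continuousOn_const).clm_apply continuousOn_const

/-- Solutions of the Riccati equation of a Hamiltonian with symmetric initial value are
symmetric. -/
theorem star_eq_of_hamiltonRiccati {h : Euc n × Euc n → ℝ}
    (hh : ContDiffOn ℝ 2 h {z | z.2 ≠ 0}) {z : ℝ → Euc n × Euc n} {a b : ℝ}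
    (hz : ContinuousOn z (Icc a b)) (hz0 : ∀ s ∈ Icc a b, (z s).2 ≠ 0)
    {R : ℝ → Euc n →L[ℝ] Euc n} (hRa : star (R a) = R a)
    (hR : ∀ s ∈ Icc a b, HasDerivWithinAt R (hamiltonRiccati h (z s) (R s)) (Icc a b) s) :
    ∀ s ∈ Icc a b, star (R s) = R s :=
  have hc := continuousOn_secondDeriv_apply hh hz hz0
  have hs := fun s hs => secondDeriv_symm hh (hz0 s hs)
  star_eq_of_riccati (A := fun s => matOp (hessPX h (z s)))
    (B := fun s => matOp (hessXP h (z s))) (C := fun s => matOp (hessPP h (z s)))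
    (D := fun s => matOp (hessXX h (z s)))
    (continuousOn_matOp fun _ _ => hc _ _) (continuousOn_matOp fun _ _ => hc _ _)
    (continuousOn_matOp fun _ _ => hc _ _)
    (fun s h' => star_eq_of_inner_eq fun u v => by
      rw [inner_hessPX, inner_hessXP, hs s h'])
    (fun s h' => star_eq_of_inner_eq fun u v => by
      rw [inner_hessPP, inner_hessPP, hs s h'])
    (fun s h' => star_eq_of_inner_eq fun u v => by
      rw [inner_hessXX, inner_hessXX, hs s h']) hRa hR

variable {F : Euc n → Set (Euc n)} {φ : Euc n → ℝ} {t₀ T : ℝ} {x₀ : Euc n} {x p : ℝ → Euc n}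

/-- The value function is constant along an optimal trajectory. -/
theorem MayerJets.StandingHypothesis.valueFunction_optimal (hF : StandingHypothesis F)
    (hh : ContDiffOn ℝ 2 (hamiltonian F) {z | z.2 ≠ 0}) {e : Euc n} (he : e ≠ 0)
    (hφ : Continuous φ) (hx : IsOptimal F φ T t₀ x₀ x) {t : ℝ} (ht : t ∈ Icc t₀ T) :
    valueFunction F φ T t (x t) = φ (x T) := by
  refine le_antisymm (hF.valueFunction_le hφ ht.2 (hx.1.mono ht.1 ht.2 le_rfl)) ?_
  rw [← valueFunction_of_isOptimal hx, ← hx.2.1]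
  exact hF.valueFunction_mono hh he hφ ht.1 ht.2 (hx.1.mono le_rfl ht.1 ht.2)

/-- Subjets of the value function propagate forward along extremals through the Riccati
equation. -/
theorem MayerJets.StandingHypothesis.subjet_propagation (hF : StandingHypothesis F)
    (hh : ContDiffOn ℝ 2 (hamiltonian F) {z | z.2 ≠ 0}) (hφ : Continuous φ)
    (hx : IsOptimal F φ T t₀ x₀ x) (hp : IsDualArc F φ t₀ T x p) (hp0 : ∀ t ∈ Icc t₀ T, p t ≠ 0)
    {R₀ : Matrix (Fin n) (Fin n) ℝ} (hR₀ : R₀.IsSymm)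
    (hsub : (-p t₀, -R₀) ∈ subjet (valueFunction F φ T t₀) x₀) {a : ℝ} (ha : t₀ ≤ a) (haT : a ≤ T)
    {R : ℝ → Matrix (Fin n) (Fin n) ℝ} (hR : IsRiccatiSolution (hamiltonian F) x p t₀ a R₀ R) :
    ∀ t ∈ Icc t₀ a, (-p t, -R t) ∈ subjet (valueFunction F φ T t) (x t) := by
  have ht₀ : t₀ ≤ T := ha.trans haT
  have he := hp0 t₀ ⟨le_rfl, ht₀⟩
  have hIcc : Icc t₀ a ⊆ Icc t₀ T := Icc_subset_Icc_right haT
  obtain ⟨hxd, hpd⟩ := hp.hasDerivWithinAt hh ht₀ hx.1 hp0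
  replace hxd := fun s hs => (hxd s (hIcc hs)).mono hIcc
  replace hpd := fun s hs => (hpd s (hIcc hs)).mono hIcc
  obtain ⟨hRt₀, hRd⟩ := (isRiccatiSolution_iff _).1 hR
  have hz : ContinuousOn (fun s => (x s, p s)) (Icc t₀ a) := ContinuousOn.prodMk
    (fun s hs => (hxd s hs).continuousWithinAt) fun s hs => (hpd s hs).continuousWithinAt
  have hstar : ∀ s ∈ Icc t₀ a, star (matOp (R s)) = matOp (R s) :=
    star_eq_of_hamiltonRiccati hh hz (fun s hs => hp0 s (hIcc hs))
      (isSymm_iff_star_matOp.1 (by rwa [hRt₀])) hRd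
  have hsymm := fun s hs => inner_eq_of_star_eq (hstar s hs)
  obtain ⟨C, hC0, hfb⟩ := hF.exists_feedback hh ha (fun s hs => hp0 s (hIcc hs)) hxd hpd hRd hsymm
  intro t ht
  refine mem_subjet_iff.2 ⟨(isSymm_iff_star_matOp.2 (hstar t ht)).neg, fun ε hε => ?_⟩
  -- The drift of `ψ` over time at most `a - t₀` costs `η (a - t₀) ‖d‖²`, and the subjet at `t₀`
  -- costs `η ‖δ t₀‖² ≤ η C² ‖d‖²`; together they make `ε ‖d‖²`.
  set η := ε / (a - t₀ + C ^ 2) with hη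
  have hden : 0 < a - t₀ + C ^ 2 := by
    have : 0 ≤ a - t₀ := sub_nonneg.2 ha
    positivity
  have hη0 : 0 < η := by positivity
  obtain ⟨r, hr, hfb⟩ := hfb η hη0
  obtain ⟨r', hr', hsub'⟩ := Metric.eventually_nhds_iff.1 ((mem_subjet_iff.1 hsub).2 η hη0)
  filter_upwards [Metric.ball_mem_nhds (x t) (show 0 < min r (r' / C) by positivity)] with y hy
  rw [mem_ball_iff_norm] at hy
  set d := y - x t with hd
  -- The feedback passes through `y` at time `t` and is used backwards, on `[t₀, t]`.
  obtain ⟨δ, hδt, htraj, hδC, ψ', hψ, hψ'⟩ := hfb t ht d (hy.le.trans (min_le_left _ _))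
  have ht₀a : t₀ ∈ Icc t₀ a := ⟨le_rfl, ha⟩
  have h1 : |(inner ℝ (p t) (δ t) + 1 / 2 * inner ℝ (matOp (R t) (δ t)) (δ t)) -
      (inner ℝ (p t₀) (δ t₀) + 1 / 2 * inner ℝ (matOp (R t₀) (δ t₀)) (δ t₀))| ≤
        η * ‖d‖ ^ 2 * (a - t₀) := by
    have hb : ∀ s ∈ Icc t₀ a, ‖ψ' s‖ ≤ η * ‖d‖ ^ 2 := fun s hs => by
      have h2 := hψ' s hs
      rw [inner_hamiltonRiccati _ _ (hsymm s hs), mul_zero, sub_zero] at h2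
      exact h2
    have := (convex_Icc t₀ a).norm_image_sub_le_of_norm_hasDerivWithin_le hψ hb ht₀a ht
    refine this.trans (mul_le_mul_of_nonneg_left ?_ (by positivity))
    rw [Real.norm_of_nonneg (sub_nonneg.2 ht.1)]
    linarith [ht.2]
  have hmono := hF.valueFunction_mono hh he hφ ht.1 (ht.2.trans haT) (htraj.mono le_rfl ht.1 ht.2)
  have hδ₀ : ‖δ t₀‖ ≤ C * ‖d‖ := hδC t₀ ht₀a
  have hlow := @hsub' (x t₀ + δ t₀) (by
    rw [dist_eq_norm, ← hx.2.1, add_sub_cancel_left]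
    have h3 := hy.trans_le (min_le_right _ _)
    rw [lt_div_iff₀ hC0, mul_comm] at h3
    exact hδ₀.trans_lt h3)
  rw [valueFunction_of_isOptimal hx, ← hx.2.1, add_sub_cancel_left] at hlow
  rw [hF.valueFunction_optimal hh he hφ hx (hIcc ht)]
  have hyx : x t + δ t = y := by rw [hδt, hd]; abel
  simp only [hyx] at hmono
  rw [hδt] at h1
  have h4 : η * ‖δ t₀‖ ^ 2 ≤ η * (C * ‖d‖) ^ 2 := by gcongr
  have h5 : η * ‖d‖ ^ 2 * (a - t₀) + η * (C * ‖d‖) ^ 2 = ε * ‖d‖ ^ 2 := by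
    rw [hη]; field_simp
  have h6 := (abs_le.1 h1).1
  rw [hRt₀] at h6
  simp only [map_neg, neg_apply, inner_neg_left] at hlow ⊢
  simp only [matOp] at h6
  linarith

/-- A quadratic upper bound on the value function along an extremal, for semiconcave final cost. -/
theorem MayerJets.StandingHypothesis.valueFunction_le_quadratic (hF : StandingHypothesis F)
    (hh : ContDiffOn ℝ 2 (hamiltonian F) {z | z.2 ≠ 0}) (hφ : Continuous φ)
    (hφsc : LocallySemiconcave φ) (ht₀ : t₀ ≤ T)
    (hx : IsTrajectory F t₀ T x) (hp : IsDualArc F φ t₀ T x p)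
    (hp0 : ∀ t ∈ Icc t₀ T, p t ≠ 0) :
    ∃ C > 0, ∃ r > 0, ∀ t ∈ Icc t₀ T, ∀ d : Euc n, ‖d‖ ≤ r →
      valueFunction F φ T t (x t + d) ≤ φ (x T) - inner ℝ (p t) d + C * ‖d‖ ^ 2 := by
  obtain ⟨hxd, hpd⟩ := hp.hasDerivWithinAt hh ht₀ hx hp0
  obtain ⟨c, hc0, rφ, hrφ, hφc⟩ := hφsc.le_of_mem_clarkeGradient hp.2.2
  -- With `S = 0` the control follows the unperturbed `p`, so `ψ = ⟨p, δ⟩` varies only by `O(‖d‖²)`.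
  -- The bound on `ψ'` combines the accuracy `1` with the contribution `M C ^ 2` of `H_xx`.
  obtain ⟨C, hC0, hfb⟩ := hF.exists_feedback hh ht₀ hp0 hxd hpd
    (S := fun _ => 0) (S' := fun _ => 0) (fun s _ => hasDerivWithinAt_const _ _ _)
    (fun s _ u v => by simp)
  obtain ⟨r, hr, hfb⟩ := hfb 1 one_pos
  have hz : ContinuousOn (fun s => (x s, p s)) (Icc t₀ T) := ContinuousOn.prodMk
    (fun s hs => (hxd s hs).continuousWithinAt) fun s hs => (hpd s hs).continuousWithinAt
  obtain ⟨M, hM0, hM⟩ := ContinuousOn.exists_norm_le_Icc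
    (F := Euc n × Euc n →L[ℝ] Euc n × Euc n →L[ℝ] ℝ) ((continuousOn_secondDeriv hh).comp hz fun s hs => hp0 s hs)
  have hT0 : 0 ≤ T - t₀ := sub_nonneg.2 ht₀
  set B := 1 + M * C ^ 2 with hB
  refine ⟨B * (T - t₀) + c * C ^ 2, by positivity, min r (rφ / (2 * C)), by positivity,
    fun t ht d hd => ?_⟩
  obtain ⟨δ, hδt, htraj, hδC, ψ', hψ, hψ'⟩ := hfb t ht d (hd.trans (min_le_left _ _))
  have hTT : T ∈ Icc t₀ T := ⟨ht₀, le_rfl⟩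
  simp only [zero_apply, inner_zero_left, mul_zero, add_zero, zero_add] at hψ hψ'
  have hb : ∀ s ∈ Icc t₀ T, ‖ψ' s‖ ≤ B * ‖d‖ ^ 2 := fun s hs => by
    have h1 := hψ' s hs
    have h2 : |secondDeriv (hamiltonian F) (x s, p s) (δ s, 0) (δ s, 0)| ≤ M * (C * ‖d‖) ^ 2 := by
      have h3 : ‖(δ s, (0 : Euc n))‖ = ‖δ s‖ := by simp [Prod.norm_def]
      refine ((secondDeriv (hamiltonian F) (x s, p s)).le_opNorm₂ _ _).trans ?_
      rw [h3, mul_assoc, ← pow_two]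
      gcongr
      exacts [hM s hs, hδC s hs]
    rw [Real.norm_eq_abs, abs_le]
    rw [abs_le] at h1 h2
    have h4 : M * (C * ‖d‖) ^ 2 = M * C ^ 2 * ‖d‖ ^ 2 := by ring
    have h5 : 0 ≤ M * C ^ 2 * ‖d‖ ^ 2 := by positivity
    rw [hB]
    constructor <;> nlinarith
  have h1 := (convex_Icc t₀ T).norm_image_sub_le_of_norm_hasDerivWithin_le hψ hb ht hTT
  rw [Real.norm_eq_abs, Real.norm_of_nonneg (sub_nonneg.2 ht.2), hδt] at h1
  have h2 : B * ‖d‖ ^ 2 * (T - t) ≤ B * ‖d‖ ^ 2 * (T - t₀) :=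
    mul_le_mul_of_nonneg_left (by linarith [ht.1]) (by positivity)
  have hδT := hδC T hTT
  -- Transversality enters here: `-p T` is a generalized gradient of the semiconcave `φ` at `x T`.
  have h3 := hφc (x T + δ T) (by
    rw [add_sub_cancel_left]
    have := hd.trans (min_le_right _ _)
    rw [le_div_iff₀ (by positivity)] at this
    linarith)
  rw [add_sub_cancel_left, inner_neg_left] at h3
  have h4 : c * ‖δ T‖ ^ 2 ≤ c * (C * ‖d‖) ^ 2 := by gcongr
  have h5 := hF.valueFunction_le hφ ht.2 (htraj.mono ht.1 ht.2 le_rfl)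
  simp only [hδt] at h5
  have h6 := (abs_le.1 h1).1
  have h7 : c * (C * ‖d‖) ^ 2 = c * C ^ 2 * ‖d‖ ^ 2 := by ring
  linarith

/-- Comparison of a subjet with a quadratic upper bound. -/
theorem le_inner_of_mem_subjet {f : Euc n → ℝ} {y q : Euc n} {R : Matrix (Fin n) (Fin n) ℝ}
    (hf : (-q, -R) ∈ subjet f y) {C r : ℝ} (hC : 0 < C) (hr : 0 < r)
    (h : ∀ d : Euc n, ‖d‖ ≤ r → f (y + d) ≤ f y - inner ℝ q d + C * ‖d‖ ^ 2) (v : Euc n) :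
    -(4 * C) * ‖v‖ ^ 2 ≤ inner ℝ (matOp R v) v := by
  -- The subjet is used with error `C`, so `-½ ⟨R d, d⟩ ≤ 2 C ‖d‖²` for small `d`, whence the factor
  -- `4`. Both sides are quadratic, so scaling `v` down loses nothing.
  obtain ⟨r', hr', hsub⟩ := Metric.eventually_nhds_iff.1 ((mem_subjet_iff.1 hf).2 C hC)
  set m := min r r' with hm
  have hm0 : 0 < m := by positivity
  set t := m / (2 * (‖v‖ + 1)) with ht
  have ht0 : 0 < t := by positivity
  have htv : ‖t • v‖ < m := by
    rw [norm_smul, Real.norm_of_nonneg ht0.le, ht, div_mul_eq_mul_div, div_lt_iff₀ (by positivity)]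
    nlinarith [norm_nonneg v]
  have h1 := h (t • v) (htv.le.trans (min_le_left _ _))
  have h2 := @hsub (y + t • v) (by
    rw [dist_eq_norm, add_sub_cancel_left]; exact htv.trans_le (min_le_right _ _))
  simp only [add_sub_cancel_left, map_neg, neg_apply, inner_neg_left] at h2
  have h3 : inner ℝ (matOp R (t • v)) (t • v) = t ^ 2 * inner ℝ (matOp R v) v := by
    rw [map_smul, inner_smul_left, inner_smul_right]
    simp only [conj_trivial]
    ring
  have h4 : ‖t • v‖ ^ 2 = t ^ 2 * ‖v‖ ^ 2 := by
    rw [norm_smul, Real.norm_of_nonneg ht0.le, mul_pow]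
  rw [h3, h4] at h2
  rw [h4] at h1
  have h5 : 0 ≤ t ^ 2 * (inner ℝ (matOp R v) v + 4 * C * ‖v‖ ^ 2) := by linarith
  linarith [nonneg_of_mul_nonneg_right h5 (by positivity)]

/-- For a semiconcave final cost, the Riccati equation has a global solution. -/
theorem MayerJets.StandingHypothesis.exists_isRiccatiSolution (hF : StandingHypothesis F)
    (hh : ContDiffOn ℝ 2 (hamiltonian F) {z | z.2 ≠ 0}) (hφ : Continuous φ)
    (hφsc : LocallySemiconcave φ) (ht₀ : t₀ ≤ T) (hx : IsOptimal F φ T t₀ x₀ x)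
    (hp : IsDualArc F φ t₀ T x p) (hp0 : ∀ t ∈ Icc t₀ T, p t ≠ 0)
    {R₀ : Matrix (Fin n) (Fin n) ℝ} (hR₀ : R₀.IsSymm)
    (hsub : (-p t₀, -R₀) ∈ subjet (valueFunction F φ T t₀) x₀) :
    ∃ R : ℝ → Matrix (Fin n) (Fin n) ℝ, IsRiccatiSolution (hamiltonian F) x p t₀ T R₀ R := by
  have he := hp0 t₀ ⟨le_rfl, ht₀⟩
  obtain ⟨hxd, hpd⟩ := hp.hasDerivWithinAt hh ht₀ hx.1 hp0
  have hz : ContinuousOn (fun s => (x s, p s)) (Icc t₀ T) := ContinuousOn.prodMk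
    (fun s hs => (hxd s hs).continuousWithinAt) fun s hs => (hpd s hs).continuousWithinAt
  have hc := continuousOn_secondDeriv_apply hh hz hp0
  have hA : ContinuousOn (fun s => matOp (hessPX (hamiltonian F) (x s, p s))) (Icc t₀ T) :=
    continuousOn_matOp fun _ _ => hc _ _
  have hB : ContinuousOn (fun s => matOp (hessXP (hamiltonian F) (x s, p s))) (Icc t₀ T) :=
    continuousOn_matOp fun _ _ => hc _ _
  have hC : ContinuousOn (fun s => matOp (hessPP (hamiltonian F) (x s, p s))) (Icc t₀ T) :=
    continuousOn_matOp fun _ _ => hc _ _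
  have hD : ContinuousOn (fun s => matOp (hessXX (hamiltonian F) (x s, p s))) (Icc t₀ T) :=
    continuousOn_matOp fun _ _ => hc _ _
  obtain ⟨k, hk, r, hr, hV⟩ := hF.valueFunction_le_quadratic hh hφ hφsc ht₀ hx.1 hp hp0
  obtain ⟨M, hM⟩ := exists_norm_bound_of_riccati hA hB hD
    (C := fun s => matOp (hessPP (hamiltonian F) (x s, p s)))
    (fun s hs v => by
      rw [inner_hessPP]
      exact hF.secondDeriv_hamiltonian_nonneg hh _ (hp0 s hs) v) (matOp R₀) (4 * k)
  set toMat : (Euc n →L[ℝ] Euc n) → Matrix (Fin n) (Fin n) ℝ :=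
    fun Q => (Matrix.toEuclideanCLM (𝕜 := ℝ) (n := Fin n)).symm Q with htoMat
  have hmat : ∀ Q, matOp (toMat Q) = Q := fun Q => StarAlgEquiv.apply_symm_apply _ Q
  have hmat' : ∀ Q, toMat (matOp Q) = Q := fun Q => StarAlgEquiv.symm_apply_apply _ Q
  obtain ⟨R, hR₁, hR₂⟩ := exists_riccati_solution_of_bound ht₀ hA hB hC hD (matOp R₀) (M := M) (by
    intro c hac hcT R hRa hR
    have hsubc : Icc t₀ c ⊆ Icc t₀ T := Icc_subset_Icc_right hcT
    have hRs : IsRiccatiSolution (hamiltonian F) x p t₀ c R₀ (fun s => toMat (R s)) := by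
      refine (isRiccatiSolution_iff _).2 ⟨by simp only [hRa, hmat'], fun s hs => ?_⟩
      simp only [hmat]
      exact hR s hs
    -- Propagation on the partial interval `[t₀, c]` supplies the lower bound on `R`, with a
    -- constant that does not depend on `c`.
    have hjet := hF.subjet_propagation hh hφ hx hp hp0 hR₀ hsub hac.le hcT hRs
    refine hM c hcT R hRa hR (fun s hs => inner_eq_of_star_eq ?_) (fun s hs v => ?_) c
      (right_mem_Icc.2 hac.le)
    · exact star_eq_of_hamiltonRiccati hh (hz.mono hsubc) (fun s hs => hp0 s (hsubc hs))
        (by rw [hRa]; exact isSymm_iff_star_matOp.1 hR₀) hR s hs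
    · have := le_inner_of_mem_subjet (hjet s hs) hk hr (fun d hd => by
        rw [hF.valueFunction_optimal hh he hφ hx (hsubc hs)]
        exact hV s (hsubc hs) d hd) v
      rwa [hmat] at this)
  refine ⟨fun s => toMat (R s), (isRiccatiSolution_iff _).2
    ⟨by simp only [hR₁, hmat'], fun s hs => ?_⟩⟩
  simp only [hmat]
  exact hR₂ s hs

end Propagation

theorem mainTheorem2 (n : ℕ) (F : Euc n → Set (Euc n)) (φ : Euc n → ℝ)
    (hF : StandingHypothesis F) (hH : IsC21LocOffZero (hamiltonian F))
    (hφ : LocallyLipschitz φ)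
    (t₀ T : ℝ) (ht₀ : t₀ ≤ T) (x₀ : Euc n)
    (x : ℝ → Euc n) (hx : IsOptimal F φ T t₀ x₀ x)
    (p : ℝ → Euc n) (hp : IsDualArc F φ t₀ T x p) (hp0 : ∀ t ∈ Icc t₀ T, p t ≠ 0)
    (R₀ : Matrix (Fin n) (Fin n) ℝ) (hR₀ : R₀.IsSymm)
    (hsub : (-p t₀, -R₀) ∈ subjet (valueFunction F φ T t₀) x₀) :
    (∀ a : ℝ, t₀ < a → a ≤ T → ∀ R : ℝ → Matrix (Fin n) (Fin n) ℝ,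
      IsRiccatiSolution (hamiltonian F) x p t₀ a R₀ R →
        ∀ t ∈ Icc t₀ a, (-p t, -R t) ∈ subjet (valueFunction F φ T t) (x t)) ∧
    (LocallySemiconcave φ → ∃ R : ℝ → Matrix (Fin n) (Fin n) ℝ,
      IsRiccatiSolution (hamiltonian F) x p t₀ T R₀ R ∧
        ∀ t ∈ Icc t₀ T, (-p t, -R t) ∈ subjet (valueFunction F φ T t) (x t)) := by
  refine ⟨fun a ha haT R hR => hF.subjet_propagation hH.1 hφ.continuous hx hp hp0 hR₀ hsub ha.le
    haT hR, fun hφsc => ?_⟩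
  obtain ⟨R, hR⟩ := hF.exists_isRiccatiSolution hH.1 hφ.continuous hφsc ht₀ hx hp hp0 hR₀ hsub
  exact ⟨R, hR, hF.subjet_propagation hH.1 hφ.continuous hx hp hp0 hR₀ hsub ht₀ le_rfl hR⟩
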